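/- Let $N\ge 2$ be an integer, $p>1$, $\beta\in\mathbb R\setminus\{0\}$ and $\omega>N^2/\beta^2$. Let $\Gamma$ be the star graph consisting of $N$ half-lines $(0,\infty)$ attached to a common vertex, let $H^1(\Gamma)=\bigoplus_{j=1}^N H^1(\mathbb R^+)$ (complex-valued functions $v=(v_j)_{j=1}^N$), put $\|v\|_q^q=\sum_{j=1}^N\int_0^\infty|v_j(x)|^q\,dx$, write $v_j(0)=\lim_{x\to0+}v_j(x)$, and let $$H^1_{\mathrm{eq}}(\Gamma)=\{v\in H^1(\Gamma): v_1(x)=\dots=v_N(x),\ x>0\}.$$ For $v\in H^1(\Gamma)$ set $$F_\beta(v)=\|v'\|_2^2+\frac1\beta\Big|\sum_{j=1}^N v_j(0)\Big|^2,\qquad S_\omega(v)=\frac12F_\beta(v)+\frac\omega2\|v\|_2^2-\frac1{p+1}\|v\|_{p+1}^{p+1},\qquad I_\omega(v)=F_\beta(v)+\omega\|v\|_2^2-\|v\|_{p+1}^{p+1},$$ and let $\phi_\beta=(\tilde\phi_\beta)_{j=1}^N$, where, for $x>0$, $$\tilde\phi_\beta(x)=\left[\frac{(p+1)\omega}{2}\operatorname{sech}^2\left(\frac{(p-1)\sqrt\omega}{2}x-\tanh^{-1}\left(\frac{N}{\beta\sqrt\omega}\right)\right)\right]^{\frac1{p-1}}.$$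 Then the infimum $$d_\omega^{\mathrm{eq}}=\inf\{S_\omega(v): v\in H^1_{\mathrm{eq}}(\Gamma)\setminus\{0\},\ I_\omega(v)=0\}$$ is attained at $\phi_\beta$: one has $\phi_\beta\in H^1_{\mathrm{eq}}(\Gamma)\setminus\{0\}$, $I_\omega(\phi_\beta)=0$, and $d_\omega^{\mathrm{eq}}=S_\omega(\phi_\beta)$. -/

import Mathlib

open MeasureTheory Filter Topology Set

noncomputable section

namespace StarGraph

/-- Lebesgue measure on the half-line `(0, ∞)`. -/
def halfLine : Measure ℝ := volume.restrict (Ioi 0)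

/-- `g` is a weak derivative of `f` on `(0, ∞)`. Only the values on `(0, ∞)` matter. -/
def IsWeakDeriv (f g : ℝ → ℂ) : Prop :=
  LocallyIntegrableOn f (Ioi 0) ∧ LocallyIntegrableOn g (Ioi 0) ∧
    ∀ η : ℝ → ℝ, ContDiff ℝ ((⊤ : ℕ∞) : WithTop ℕ∞) η → HasCompactSupport η →
      tsupport η ⊆ Ioi 0 →
        ∫ x, deriv η x • f x ∂halfLine = -∫ x, η x • g x ∂halfLine

/-- `f` represents an element of the complex Sobolev space `H¹(ℝ⁺)`. -/
def MemH1 (f : ℝ → ℂ) : Prop :=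
  MemLp f 2 halfLine ∧ ∃ g : ℝ → ℂ, MemLp g 2 halfLine ∧ IsWeakDeriv f g

open Classical in
/-- The weak derivative (unique almost everywhere on `(0, ∞)`), and `0` if there is none. -/
def weakDeriv (f : ℝ → ℂ) : ℝ → ℂ :=
  if h : ∃ g : ℝ → ℂ, IsWeakDeriv f g then h.choose else 0

/-- The boundary value `f(0)`, i.e. the limit of `f(x)` as `x → 0+`. It is taken outside null
sets, so that it is the limit of the continuous representative of an element of `H¹(ℝ⁺)`,
whichever representative `f` is given. -/
def boundaryValue (f : ℝ → ℂ) : ℂ := limUnder (𝓝[>] (0 : ℝ) ⊓ ae volume) f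

/-- (Representatives of the elements of) `H¹(Γ)`, for `Γ` the star graph with `N` half-lines. -/
def H1 (N : ℕ) : Set (Fin N → ℝ → ℂ) := {v | ∀ j, MemH1 (v j)}

/-- The subspace `H¹_eq(Γ)` of the functions that have equal components. -/
def H1eq (N : ℕ) : Set (Fin N → ℝ → ℂ) := {v | v ∈ H1 N ∧ ∀ i j, v i =ᵐ[halfLine] v j}

/-- `v = 0` as an element of `H¹(Γ)`. -/
def IsZero {N : ℕ} (v : Fin N → ℝ → ℂ) : Prop := ∀ j, v j =ᵐ[halfLine] 0

/-- `‖v‖_q^q`, the `q`-th power of the norm of `L^q(Γ)`. -/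
def normPow {N : ℕ} (q : ℝ) (v : Fin N → ℝ → ℂ) : ℝ := ∑ j, ∫ x, ‖v j x‖ ^ q ∂halfLine

/-- The quadratic form `F_β(v) = ‖v'‖₂² + (1/β) |∑ⱼ vⱼ(0)|²` of the `δ'_s` coupling. -/
def quadForm {N : ℕ} (β : ℝ) (v : Fin N → ℝ → ℂ) : ℝ :=
  normPow 2 (fun j => weakDeriv (v j)) + 1 / β * ‖∑ j, boundaryValue (v j)‖ ^ 2

/-- The action functional `S_ω`. -/
def action {N : ℕ} (p ω β : ℝ) (v : Fin N → ℝ → ℂ) : ℝ :=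
  1 / 2 * quadForm β v + ω / 2 * normPow 2 v - 1 / (p + 1) * normPow (p + 1) v

/-- The Nehari functional `I_ω`. -/
def nehari {N : ℕ} (p ω β : ℝ) (v : Fin N → ℝ → ℂ) : ℝ :=
  quadForm β v + ω * normPow 2 v - normPow (p + 1) v

/-- The constraint set `{v ∈ H¹_eq(Γ) \ {0} : I_ω(v) = 0}`. -/
def nehariEq (N : ℕ) (p ω β : ℝ) : Set (Fin N → ℝ → ℂ) :=
  {v | v ∈ H1eq N ∧ ¬ IsZero v ∧ nehari p ω β v = 0}

/-- `d_ω^eq`, the infimum of the action over the constraint set. -/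
def dEq (N : ℕ) (p ω β : ℝ) : ℝ := sInf (action p ω β '' nehariEq N p ω β)

/-- The common component of the symmetric profile:
`[(p+1)ω/2 · sech²((p-1)√ω/2 · x - artanh(N/(β√ω)))]^(1/(p-1))`. -/
def profileComponent (N : ℕ) (p ω β x : ℝ) : ℝ :=
  ((p + 1) * ω / 2 *
    (1 / Real.cosh ((p - 1) * √ω / 2 * x - Real.artanh (N / (β * √ω)))) ^ 2) ^ (1 / (p - 1))

/-- The symmetric profile `φ_β`. -/
def profile (N : ℕ) (p ω β : ℝ) : Fin N → ℝ → ℂ :=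
  fun _ x => (profileComponent N p ω β x : ℂ)

end StarGraph

end

namespace StarGraph

/-! All components of a function in `H1eq N` agree, so action and Nehari functional are `N` times
those of one function `U` on the half-line with the Robin term `γ |U(0)|²`, `γ = N / β`. No
existence of minimizers or classification of critical points is needed: the level is bounded below
directly.

Write `w` for `orbitSlope`, so that `w(t)² = ω t² - 2/(p+1) t^(p+1)` up to the height `M` of the
soliton, and `H` for its primitive. As long as `|U| ≤ M`, the energy density is `(|U'|² + w(|U|)²)/2
≥ w(|U|) |U'|`, which dominates the variation of `H(|U|)`. Since `|U|` goes from `|U(0)|` to its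
maximum `m` and then to `0`, the energy without the Robin term is at least `2 H(m) - H(|U(0)|)`
(`orbitPrimitive_le_energy`). It remains to minimize `γ b²/2 - H(b)`, whose derivative `γ b - w(b)`
vanishes, for `γ ≥ 0`, at the boundary value `a` of the soliton; for `γ < 0` the function decreases
and the scaling is chosen accordingly.

The bound `|U| ≤ M` comes from scaling: on the Nehari set the action of `s U` is largest at `s = 1`
(`sq_sub_rpow_le`), so it is enough to bound the action of one multiple of `U`, with maximum `M` or
with boundary value `a` (`exists_orbitLevel_le_action_smul`).

The soliton satisfies `φ'² = w(φ)²`, so every inequality is an equality for it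
(`soliton_orbitLevel`), and its boundary slope gives the Nehari identity (`soliton_nehari`). -/

/-! ### Weak derivatives, primitives and boundary values on the half-line. -/

theorem intervalIntegrable_of_locallyIntegrable {E : Type*} [NormedAddCommGroup E] {g : ℝ → E}
    (hg : LocallyIntegrable g volume) (a b : ℝ) : IntervalIntegrable g volume a b :=
  intervalIntegrable_iff.2
    ((hg.integrableOn_isCompact isCompact_uIcc).mono_set uIoc_subset_uIcc)

/-- A locally integrable function on the line, all of whose integrals against derivatives of test
functions on `(0, ∞)` vanish, is constant almost everywhere on `(0, ∞)`. -/
theorem exists_const_of_integral_deriv_smul_eq_zero {h : ℝ → ℂ} (hh : LocallyIntegrable h volume)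
    (H : ∀ η : ℝ → ℝ, ContDiff ℝ ((⊤ : ℕ∞) : WithTop ℕ∞) η → HasCompactSupport η →
      tsupport η ⊆ Ioi 0 → ∫ x, deriv η x • h x = 0) :
    ∃ c : ℂ, ∀ᵐ x, x ∈ Ioi (0 : ℝ) → h x = c := by
  -- A fixed test function of mass one, supported in `[1, 3]`; the constant is the mean of `h`
  -- against it.
  let b : ContDiffBump (2 : ℝ) := ⟨1 / 2, 1, by norm_num, by norm_num⟩
  let ρ : ℝ → ℝ := b.normed volume
  have hρc : ContDiff ℝ ((⊤ : ℕ∞) : WithTop ℕ∞) ρ := b.contDiff_normed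
  have hρs : HasCompactSupport ρ := b.hasCompactSupport_normed
  have hρt : tsupport ρ = Icc 1 3 := by
    rw [b.tsupport_normed_eq, Real.closedBall_eq_Icc]; norm_num [b]
  have hρi : ∫ x, ρ x = 1 := b.integral_normed
  refine ⟨∫ x, ρ x • h x, ?_⟩
  have key : ∀ᵐ x, x ∈ Ioi (0 : ℝ) → (h x - ∫ x, ρ x • h x) = 0 := by
    refine isOpen_Ioi.ae_eq_zero_of_integral_contDiff_smul_eq_zero
      ((hh.sub (locallyIntegrable_const _)).locallyIntegrableOn _) fun ψ hψ hψs hψt => ?_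
    set K := ∫ x, ψ x with hK
    -- Removing the mean of `ψ` makes the primitive of `χ` compactly supported, hence an admissible
    -- test function.
    let χ : ℝ → ℝ := fun x => ψ x - K * ρ x
    have hχc : ContDiff ℝ ((⊤ : ℕ∞) : WithTop ℕ∞) χ := hψ.sub (contDiff_const.mul hρc)
    have hψi : Integrable ψ := hψ.continuous.integrable_of_hasCompactSupport hψs
    have hρI : Integrable ρ := hρc.continuous.integrable_of_hasCompactSupport hρs
    have hχ0 : ∫ x, χ x = 0 := by
      have : ∫ x, χ x = (∫ x, ψ x) - ∫ x, K * ρ x := integral_sub hψi (hρI.const_mul K)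
      rw [this, integral_const_mul, hρi, ← hK]; ring
    obtain ⟨a, ⟨haS, ha⟩⟩ := (hψs.union hρs).exists_isLeast ⟨2, Or.inr (by
      rw [hρt]; norm_num)⟩
    obtain ⟨d, hd⟩ := (hψs.union hρs).bddAbove
    have ha0 : 0 < a := by
      rcases haS with h | h
      · exact hψt h
      · change a ∈ tsupport ρ at h; rw [hρt] at h; linarith [h.1]
    have hχz : ∀ x, x ∉ Icc a d → χ x = 0 := by
      intro x hx
      have h1 : x ∉ tsupport ψ := fun h => hx ⟨ha (Or.inl h), hd (Or.inl h)⟩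
      have h2 : x ∉ tsupport ρ := fun h => hx ⟨ha (Or.inr h), hd (Or.inr h)⟩
      simp [χ, image_eq_zero_of_notMem_tsupport h1, image_eq_zero_of_notMem_tsupport h2]
    let η : ℝ → ℝ := fun x => ∫ t in (0 : ℝ)..x, χ t
    have hηd : ∀ x, HasDerivAt η (χ x) x := fun x =>
      (hχc.continuous.integral_hasStrictDerivAt 0 x).hasDerivAt
    have hηd' : deriv η = χ := funext fun x => (hηd x).deriv
    have hηc : ContDiff ℝ ((⊤ : ℕ∞) : WithTop ℕ∞) η := by
      rw [contDiff_infty_iff_deriv, hηd']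
      exact ⟨fun x => (hηd x).differentiableAt, hχc⟩
    have hηz : ∀ x, x ∉ Icc a d → η x = 0 := by
      intro x hx
      rcases lt_or_ge x a with hxa | hxa
      · refine (intervalIntegral.integral_congr (g := fun _ => 0) fun t ht => hχz t ?_).trans
          (by simp)
        intro h
        rcases le_total 0 x with h0 | h0
        · rw [uIcc_of_le h0] at ht; linarith [ht.2, h.1]
        · rw [uIcc_of_ge h0] at ht; linarith [ht.2, h.1]
      · have hxd : d < x := by by_contra h'; exact hx ⟨hxa, not_lt.1 h'⟩
        have h0 : 0 ≤ x := ha0.le.trans hxa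
        rw [← hχ0]
        change ∫ t in (0 : ℝ)..x, χ t = _
        rw [intervalIntegral.integral_of_le h0]
        refine setIntegral_eq_integral_of_forall_compl_eq_zero fun t ht => hχz t fun h => ht ?_
        exact ⟨ha0.trans_le h.1, h.2.trans hxd.le⟩
    have hηt : tsupport η ⊆ Icc a d :=
      closure_minimal (fun x hx => by by_contra h; exact hx (hηz x h)) isClosed_Icc
    have := H η hηc (isCompact_Icc.of_isClosed_subset (isClosed_tsupport _) hηt)
      fun x hx => ha0.trans_le (hηt hx).1
    rw [hηd'] at this
    have i1 : Integrable fun x => ψ x • h x :=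
      hh.integrable_smul_left_of_hasCompactSupport hψ.continuous hψs
    have i2 : Integrable fun x => ρ x • h x :=
      hh.integrable_smul_left_of_hasCompactSupport hρc.continuous hρs
    have e : ∫ x, χ x • h x = (∫ x, ψ x • h x) - K • ∫ x, ρ x • h x := by
      rw [← integral_smul, ← integral_sub (g := fun x => K • ρ x • h x) i1 (i2.smul K)]
      congr 1; ext1 x
      simp only [χ, sub_smul, mul_smul]
    simp only [smul_sub]
    rw [integral_sub i1 (hψi.smul_const _), integral_smul_const, ← e, this]
  filter_upwards [key] with x hx h using sub_eq_zero.1 (hx h)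

/-- Integration by parts of a real test function against the primitive of a locally integrable
function. -/
theorem integral_deriv_mul_primitive {g : ℝ → ℝ} (hg : LocallyIntegrable g volume) (c : ℝ)
    {η : ℝ → ℝ} (hη : ContDiff ℝ ((⊤ : ℕ∞) : WithTop ℕ∞) η) {a b : ℝ} (ha : η a = 0)
    (hb : η b = 0) :
    ∫ x in a..b, deriv η x * (c + ∫ t in (0 : ℝ)..x, g t) = -∫ x in a..b, η x * g x := by
  have hi : ∀ a b, IntervalIntegrable g volume a b := intervalIntegrable_of_locallyIntegrable hg
  have hη1 : ContDiffOn ℝ 1 η (uIcc a b) := (hη.of_le (by exact_mod_cast le_top)).contDiffOn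
  have acη := hη1.absolutelyContinuousOnInterval
  have acg0 : AbsolutelyContinuousOnInterval (fun x => ∫ t in (0 : ℝ)..x, g t) a b := by
    -- The primitive is rebased at `a`, as `0` need not lie between `a` and `b`.
    have h1 := (hi a b).absolutelyContinuousOnInterval_intervalIntegral (c := a) left_mem_uIcc
    have h2 : AbsolutelyContinuousOnInterval (fun _ : ℝ => ∫ t in (0 : ℝ)..a, g t) a b :=
      (contDiffOn_const (n := 1)).absolutelyContinuousOnInterval
    have e : (fun x => ∫ t in (0 : ℝ)..x, g t) =
        fun x => (∫ t in (0 : ℝ)..a, g t) + ∫ t in a..x, g t := funext fun x =>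
      (intervalIntegral.integral_add_adjacent_intervals (hi _ _) (hi _ _)).symm
    rw [e]
    exact h2.fun_add h1
  have acg : AbsolutelyContinuousOnInterval (fun x => c + ∫ t in (0 : ℝ)..x, g t) a b :=
    AbsolutelyContinuousOnInterval.fun_add
      (contDiffOn_const (n := 1)).absolutelyContinuousOnInterval acg0
  have := acg.integral_mul_deriv_eq_deriv_mul acη
  simp only [ha, hb, mul_zero, sub_zero, zero_sub] at this
  simp only [mul_comm (deriv η _)]
  rw [this]
  congr 1
  refine intervalIntegral.integral_congr_ae ?_
  filter_upwards [_root_.LocallyIntegrable.ae_hasDerivAt_integral hg] with x hx _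
  rw [((hx 0).const_add c).deriv, mul_comm]

theorem locallyIntegrable_re {g : ℝ → ℂ} (hg : LocallyIntegrable g volume) :
    LocallyIntegrable (fun x => (g x).re) volume := fun x => by
  obtain ⟨s, hs, h⟩ := hg x
  exact ⟨s, hs, h.re⟩

theorem locallyIntegrable_im {g : ℝ → ℂ} (hg : LocallyIntegrable g volume) :
    LocallyIntegrable (fun x => (g x).im) volume := fun x => by
  obtain ⟨s, hs, h⟩ := hg x
  exact ⟨s, hs, h.im⟩

theorem continuous_primitive {g : ℝ → ℂ} (hg : LocallyIntegrable g volume) (c : ℂ) :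
    Continuous fun x => c + ∫ t in (0 : ℝ)..x, g t :=
  continuous_const.add (intervalIntegral.continuous_primitive (intervalIntegrable_of_locallyIntegrable hg) 0)

theorem setIntegral_Ioi_eq_intervalIntegral {E : Type*} [NormedAddCommGroup E] [NormedSpace ℝ E]
    {F : ℝ → E} {R : ℝ} (hR : 0 ≤ R) (hF : ∀ x, R < x → F x = 0) :
    ∫ x, F x ∂halfLine = ∫ x in (0 : ℝ)..R, F x := by
  rw [halfLine, intervalIntegral.integral_of_le hR]
  refine setIntegral_eq_of_subset_of_forall_sdiff_eq_zero measurableSet_Ioi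
    (fun x hx => hx.1) fun x hx => hF x ?_
  by_contra h
  exact hx.2 ⟨hx.1, not_lt.1 h⟩

/-- The primitive of a locally integrable function has that function as its weak derivative. -/
theorem isWeakDeriv_primitive {g : ℝ → ℂ} (hg : LocallyIntegrable g volume) (c : ℂ) :
    IsWeakDeriv (fun x => c + ∫ t in (0 : ℝ)..x, g t) g := by
  refine ⟨(continuous_primitive hg c).locallyIntegrable.locallyIntegrableOn _,
    hg.locallyIntegrableOn _, fun η hη hηs hηt => ?_⟩
  obtain ⟨R, hR⟩ := hηs.bddAbove
  have hηR : ∀ x, max R 0 < x → x ∉ tsupport η := fun x hx h =>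
    absurd (hR h) (not_le.2 ((le_max_left _ _).trans_lt hx))
  have h0 : η 0 = 0 := image_eq_zero_of_notMem_tsupport fun h => lt_irrefl (0 : ℝ) (hηt h)
  have h1 : η (max R 0 + 1) = 0 := image_eq_zero_of_notMem_tsupport (hηR _ (by linarith))
  have hpos : 0 ≤ max R 0 + 1 := by positivity
  have hcd : Continuous (deriv η) := hη.continuous_deriv (by exact_mod_cast le_top)
  have hi : ∀ a b, IntervalIntegrable g volume a b := intervalIntegrable_of_locallyIntegrable hg
  rw [setIntegral_Ioi_eq_intervalIntegral hpos, setIntegral_Ioi_eq_intervalIntegral hpos]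
  · have i1 : IntervalIntegrable (fun x => deriv η x • (c + ∫ t in (0 : ℝ)..x, g t)) volume 0
        (max R 0 + 1) := (hcd.smul (continuous_primitive hg c)).intervalIntegrable _ _
    have i2 : IntervalIntegrable (fun x => η x • g x) volume 0 (max R 0 + 1) :=
      (hi _ _).continuousOn_smul hη.continuous.continuousOn
    have reI : ∀ {F : ℝ → ℂ} {a b : ℝ}, IntervalIntegrable F volume a b →
        (∫ x in a..b, F x).re = ∫ x in a..b, (F x).re := fun hF =>
      (Complex.reCLM.intervalIntegral_comp_comm hF).symm
    have imI : ∀ {F : ℝ → ℂ} {a b : ℝ}, IntervalIntegrable F volume a b →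
        (∫ x in a..b, F x).im = ∫ x in a..b, (F x).im := fun hF =>
      (Complex.imCLM.intervalIntegral_comp_comm hF).symm
    apply Complex.ext
    · rw [Complex.neg_re, reI i1, reI i2]
      simpa [reI (hi _ _), mul_add] using
        integral_deriv_mul_primitive (locallyIntegrable_re hg) c.re hη h0 h1
    · rw [Complex.neg_im, imI i1, imI i2]
      simpa [imI (hi _ _), mul_add] using
        integral_deriv_mul_primitive (locallyIntegrable_im hg) c.im hη h0 h1
  · intro x hx
    rw [image_eq_zero_of_notMem_tsupport (hηR x (by linarith)), zero_smul]
  · intro x hx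
    have : x ∉ tsupport (deriv η) := fun h => hηR x (by linarith) (tsupport_deriv_subset h)
    rw [image_eq_zero_of_notMem_tsupport this, zero_smul]

/-- Weak derivatives are unique almost everywhere. -/
theorem IsWeakDeriv.ae_eq {f g₁ g₂ : ℝ → ℂ} (h₁ : IsWeakDeriv f g₁) (h₂ : IsWeakDeriv f g₂) :
    g₁ =ᵐ[halfLine] g₂ := by
  have key : ∀ᵐ x, x ∈ Ioi (0 : ℝ) → (g₁ x - g₂ x) = 0 := by
    refine isOpen_Ioi.ae_eq_zero_of_integral_contDiff_smul_eq_zero (h₁.2.1.sub h₂.2.1)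
      fun η hη hηs hηt => ?_
    have e := (h₁.2.2 η hη hηs hηt).symm.trans (h₂.2.2 η hη hηs hηt)
    rw [neg_inj, halfLine] at e
    have ii : ∀ {g : ℝ → ℂ}, LocallyIntegrableOn g (Ioi 0) →
        Integrable (fun x => η x • g x) := by
      intro g hg
      have : IntegrableOn (fun x => η x • g x) (tsupport η) := by
        have := hg.integrableOn_compact_subset hηt hηs
        exact this.continuousOn_smul hη.continuous.continuousOn hηs
      rwa [integrableOn_iff_integrable_of_support_subset] at this
      exact fun x hx => subset_tsupport _ fun h => hx (by simp [h])
    have ee : ∀ {g : ℝ → ℂ}, ∫ x in Ioi 0, η x • g x = ∫ x, η x • g x := fun {g} =>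
      setIntegral_eq_integral_of_forall_compl_eq_zero fun x hx => by
        rw [image_eq_zero_of_notMem_tsupport fun h => hx (hηt h), zero_smul]
    rw [ee, ee] at e
    simp only [smul_sub]
    rw [integral_sub (ii h₁.2.1) (ii h₂.2.1), e, sub_self]
  rw [EventuallyEq, halfLine, ae_restrict_iff' measurableSet_Ioi]
  filter_upwards [key] with x hx h using sub_eq_zero.1 (hx h)

theorem IsWeakDeriv.weakDeriv_ae_eq {f g : ℝ → ℂ} (h : IsWeakDeriv f g) :
    weakDeriv f =ᵐ[halfLine] g := by
  have hex : ∃ g : ℝ → ℂ, IsWeakDeriv f g := ⟨g, h⟩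
  rw [weakDeriv, dif_pos hex]
  exact hex.choose_spec.ae_eq h

theorem IsWeakDeriv.congr_left {f₁ f₂ g : ℝ → ℂ} (h : IsWeakDeriv f₁ g)
    (hf : f₁ =ᵐ[halfLine] f₂) : IsWeakDeriv f₂ g := by
  refine ⟨fun x hx => ?_, h.2.1, fun η hη hηs hηt => ?_⟩
  · obtain ⟨s, hs, hi⟩ := h.1 x hx
    refine ⟨s ∩ Ioi 0, inter_mem hs self_mem_nhdsWithin, ?_⟩
    refine (hi.mono_set inter_subset_left).congr_fun_ae ?_
    exact ae_restrict_of_ae_restrict_of_subset inter_subset_right hf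
  · rw [← h.2.2 η hη hηs hηt]
    refine integral_congr_ae ?_
    filter_upwards [hf] with x hx
    rw [hx]

/-- Intervals `(0, u)` have positive measure. Without this, limits along the filter in
`boundaryValue` would not be unique. -/
instance neBot_nhdsGT_inf_ae : (𝓝[>] (0 : ℝ) ⊓ ae volume).NeBot := by
  rw [inf_neBot_iff]
  intro s hs t ht
  obtain ⟨u, hu, hus⟩ := (mem_nhdsGT_iff_exists_Ioo_subset' (show (0 : ℝ) < 1 by norm_num)).1 hs
  by_contra hne
  rw [not_nonempty_iff_eq_empty] at hne
  have hsub : Ioo 0 u ⊆ tᶜ := fun x hx hxt => by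
    have : x ∈ s ∩ t := ⟨hus hx, hxt⟩
    rw [hne] at this; exact this
  have h0 := measure_mono_null hsub (mem_ae_iff.1 ht)
  rw [Real.volume_Ioo, ENNReal.ofReal_eq_zero] at h0
  have : (0 : ℝ) < u := hu
  linarith

theorem boundaryValue_eq {f U : ℝ → ℂ} (hU : Continuous U) (h : f =ᵐ[halfLine] U) :
    boundaryValue f = U 0 := by
  refine Tendsto.limUnder_eq ?_
  have h1 : Tendsto U (𝓝[>] (0 : ℝ) ⊓ ae volume) (𝓝 (U 0)) :=
    (hU.tendsto 0).mono_left (inf_le_left.trans nhdsWithin_le_nhds)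
  refine h1.congr' ?_
  rw [EventuallyEq, halfLine, ae_restrict_iff' measurableSet_Ioi] at h
  have h2 : ∀ᶠ x in 𝓝[>] (0 : ℝ), x ∈ Ioi (0 : ℝ) := self_mem_nhdsWithin
  filter_upwards [h2.filter_mono inf_le_left, h.filter_mono inf_le_right] with x hx hx'
  exact (hx' hx).symm

/-- An element of `H¹(ℝ⁺)` is almost everywhere the primitive of a square integrable function. -/
theorem MemH1.exists_primitive {f : ℝ → ℂ} (hf : MemH1 f) :
    ∃ (c : ℂ) (g : ℝ → ℂ), MemLp g 2 volume ∧ f =ᵐ[halfLine] fun x => c + ∫ t in (0 : ℝ)..x, g t := by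
  obtain ⟨hf2, g, hg2, hw⟩ := hf
  -- Extension by zero gives functions on the whole line, locally integrable up to and across `0`,
  -- so the primitive can start at `0`.
  have hfI : MemLp ((Ioi 0).indicator f) 2 volume :=
    (memLp_indicator_iff_restrict measurableSet_Ioi).2 hf2
  have hgI : MemLp ((Ioi 0).indicator g) 2 volume :=
    (memLp_indicator_iff_restrict measurableSet_Ioi).2 hg2
  have hfl := hfI.locallyIntegrable (by norm_num)
  have hgl := hgI.locallyIntegrable (by norm_num)
  have hP := isWeakDeriv_primitive hgl 0
  have hcP := continuous_primitive hgl 0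
  obtain ⟨c, hc⟩ := exists_const_of_integral_deriv_smul_eq_zero (hfl.sub hcP.locallyIntegrable)
    fun η hη hηs hηt => by
      have e1 := hw.2.2 η hη hηs hηt
      have e2 := hP.2.2 η hη hηs hηt
      have e3 : ∫ x, η x • (Ioi 0).indicator g x ∂halfLine = ∫ x, η x • g x ∂halfLine := by
        refine setIntegral_congr_fun measurableSet_Ioi fun x hx => ?_
        simp only [indicator_of_mem hx]
      have hcd : Continuous (deriv η) := hη.continuous_deriv (by exact_mod_cast le_top)
      have hz : ∀ x, x ∉ Ioi (0 : ℝ) → deriv η x = 0 := fun x hx =>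
        image_eq_zero_of_notMem_tsupport fun h => hx (hηt (tsupport_deriv_subset h))
      have e4 : ∫ x, deriv η x • f x ∂halfLine = ∫ x, deriv η x • (Ioi 0).indicator f x := by
        rw [halfLine, ← integral_indicator measurableSet_Ioi]
        congr 1; ext1 x
        by_cases hx : x ∈ Ioi (0 : ℝ) <;> simp [hx]
      have e5 : ∫ x, deriv η x • (0 + ∫ t in (0 : ℝ)..x, (Ioi 0).indicator g t) ∂halfLine
          = ∫ x, deriv η x • (0 + ∫ t in (0 : ℝ)..x, (Ioi 0).indicator g t) :=
        setIntegral_eq_integral_of_forall_compl_eq_zero fun x hx => by rw [hz x hx, zero_smul]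
      simp only [Pi.sub_apply, smul_sub]
      rw [integral_sub, ← e4, ← e5, e1, e2, e3, sub_self]
      · exact hfl.integrable_smul_left_of_hasCompactSupport hcd hηs.deriv
      · exact hcP.locallyIntegrable.integrable_smul_left_of_hasCompactSupport hcd hηs.deriv
  refine ⟨c, _, hgI, ?_⟩
  rw [EventuallyEq, halfLine, ae_restrict_iff' measurableSet_Ioi]
  filter_upwards [hc] with x hx h0
  have := hx h0
  simp only [Pi.sub_apply, indicator_of_mem h0, zero_add] at this
  rw [← this]; ring

/-! ### Chain rule inequality and decay at infinity. -/

/-- A chain rule inequality for functions whose increments are controlled by an integral. -/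
theorem abs_comp_sub_le_integral {r ρ H w : ℝ → ℝ} (hr : Continuous r)
    (hρ : LocallyIntegrable ρ volume) (hρ0 : ∀ x, 0 ≤ ρ x)
    (hrρ : ∀ x y, x ≤ y → |r y - r x| ≤ ∫ t in x..y, ρ t)
    (hw : Continuous w) (hH : ∀ t, HasDerivAt H (w t) t) {a b : ℝ} (hab : a ≤ b) :
    |H (r b) - H (r a)| ≤ ∫ t in a..b, |w (r t)| * ρ t := by
  have hi := intervalIntegrable_of_locallyIntegrable hρ
  have hwr : Continuous fun t => |w (r t)| := (hw.comp hr).abs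
  have hHc : Continuous H := continuous_iff_continuousAt.2 fun t => (hH t).continuousAt
  have hi2 : ∀ x y, IntervalIntegrable (fun t => |w (r t)| * ρ t) volume x y := fun x y =>
    (hi x y).continuousOn_mul hwr.continuousOn
  -- The slack `ε` absorbs the oscillation of `w ∘ r` on short intervals: half is spent in the mean
  -- value inequality, half in passing from `w (r x)` back to `w (r t)`. The inequality then
  -- propagates from `a` to `b` by continuous induction.
  have main : ∀ ε > 0, |H (r b) - H (r a)| ≤ ∫ t in a..b, (|w (r t)| + ε) * ρ t := by
    intro ε hε
    have hi3 : ∀ x y, IntervalIntegrable (fun t => (|w (r t)| + ε) * ρ t) volume x y := fun x y =>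
      (hi x y).continuousOn_mul (hwr.add continuous_const).continuousOn
    have hsub : Icc a b ⊆ {x | |H (r x) - H (r a)| ≤ ∫ t in a..x, (|w (r t)| + ε) * ρ t} := by
      refine IsClosed.Icc_subset_of_forall_mem_nhdsWithin ?_ (by simp) ?_
      · refine IsClosed.inter (isClosed_le ?_ ?_) isClosed_Icc
        · exact ((hHc.comp hr).sub continuous_const).abs
        · exact intervalIntegral.continuous_primitive hi3 a
      · rintro x ⟨hx, -⟩
        obtain ⟨δ, hδ, hwδ⟩ := Metric.continuousAt_iff.1 (hw.continuousAt (x := r x)) (ε / 2)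
          (by positivity)
        have h1 : ∀ᶠ y in 𝓝 x, dist (r y) (r x) < δ := Metric.tendsto_nhds.1 (hr.tendsto x) δ hδ
        obtain ⟨l, hl, hlδ⟩ := Metric.eventually_nhds_iff.1 h1
        have h2 : Ioo x (x + l) ∈ 𝓝[>] x := Ioo_mem_nhdsGT (by linarith)
        filter_upwards [h2] with y hy
        have hball : ∀ z ∈ Icc x y, r z ∈ Metric.ball (r x) δ := fun z hz => by
          refine hlδ ?_
          rw [Real.dist_eq, abs_lt]
          constructor <;> linarith [hz.1, hz.2, hy.2]
        have hstep : |H (r y) - H (r x)| ≤ (|w (r x)| + ε / 2) * |r y - r x| := by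
          refine Convex.norm_image_sub_le_of_norm_hasDerivWithin_le (f := H) (f' := w)
            (s := Metric.ball (r x) δ) (fun t _ => (hH t).hasDerivWithinAt) (fun t ht => ?_)
            (convex_ball _ _) (hball x ⟨le_rfl, hy.1.le⟩) (hball y ⟨hy.1.le, le_rfl⟩)
          have := hwδ ht
          rw [Real.dist_eq] at this
          have h3 := abs_sub_abs_le_abs_sub (w t) (w (r x))
          rw [Real.norm_eq_abs]
          linarith
        have hstep2 : |H (r y) - H (r x)| ≤ ∫ t in x..y, (|w (r t)| + ε) * ρ t := by
          refine hstep.trans ((mul_le_mul_of_nonneg_left (hrρ x y hy.1.le) (by positivity)).trans ?_)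
          rw [← intervalIntegral.integral_const_mul]
          refine intervalIntegral.integral_mono_on hy.1.le ((hi x y).const_mul _) (hi3 x y)
            fun t ht => mul_le_mul_of_nonneg_right ?_ (hρ0 t)
          have := hwδ (hball t ht)
          rw [Real.dist_eq, abs_sub_comm] at this
          have h3 := abs_sub_abs_le_abs_sub (w (r x)) (w (r t))
          linarith
        simp only [mem_ofPred_eq] at hx ⊢
        rw [← intervalIntegral.integral_add_adjacent_intervals (hi3 a x) (hi3 x y)]
        have := abs_sub_le (H (r y)) (H (r x)) (H (r a))
        linarith
    exact hsub ⟨hab, le_rfl⟩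
  have hlim : Tendsto (fun ε : ℝ => (∫ t in a..b, |w (r t)| * ρ t) + ε * ∫ t in a..b, ρ t)
      (𝓝[>] 0) (𝓝 ((∫ t in a..b, |w (r t)| * ρ t) + 0 * ∫ t in a..b, ρ t)) :=
    (Continuous.tendsto (by fun_prop) 0).mono_left nhdsWithin_le_nhds
  rw [zero_mul, add_zero] at hlim
  refine ge_of_tendsto hlim ?_
  filter_upwards [self_mem_nhdsWithin] with ε hε
  refine (main ε hε).trans_eq ?_
  rw [← intervalIntegral.integral_const_mul, ← intervalIntegral.integral_add (hi2 a b)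
    ((hi a b).const_mul ε)]
  simp only [add_mul]

theorem locallyIntegrable_norm {g : ℝ → ℂ} (hg : LocallyIntegrable g volume) :
    LocallyIntegrable (fun x => ‖g x‖) volume := fun x => by
  obtain ⟨s, hs, h⟩ := hg x
  exact ⟨s, hs, h.norm⟩

section Primitive

variable {g : ℝ → ℂ} {c : ℂ}

theorem abs_norm_primitive_sub_le (hg : LocallyIntegrable g volume) {x y : ℝ} (hxy : x ≤ y) :
    |‖c + ∫ t in (0 : ℝ)..y, g t‖ - ‖c + ∫ t in (0 : ℝ)..x, g t‖| ≤ ∫ t in x..y, ‖g t‖ := by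
  have hi := intervalIntegrable_of_locallyIntegrable hg
  refine (abs_norm_sub_norm_le _ _).trans ?_
  rw [add_sub_add_left_eq_sub, intervalIntegral.integral_interval_sub_left (hi _ _) (hi _ _)]
  exact intervalIntegral.norm_integral_le_integral_norm hxy

theorem integrableOn_mul_norm (hg : MemLp g 2 volume) {U : ℝ → ℂ} (hU : MemLp U 2 halfLine) :
    IntegrableOn (fun x => ‖U x‖ * ‖g x‖) (Ioi 0) :=
  hU.norm.integrable_mul (hg.restrict (Ioi 0)).norm

theorem integrableOn_norm_sq {U : ℝ → ℂ} (hU : MemLp U 2 halfLine) :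
    IntegrableOn (fun x => ‖U x‖ ^ 2) (Ioi 0) := hU.integrable_norm_pow (by norm_num)

/-- Elements of `H¹` of the half-line vanish at infinity. -/
theorem tendsto_norm_primitive_zero (hg : MemLp g 2 volume)
    (hU : MemLp (fun x => c + ∫ t in (0 : ℝ)..x, g t) 2 halfLine) :
    Tendsto (fun x => ‖c + ∫ t in (0 : ℝ)..x, g t‖) atTop (𝓝 0) := by
  have hgl := hg.locallyIntegrable (by norm_num)
  set U : ℝ → ℂ := fun x => c + ∫ t in (0 : ℝ)..x, g t with hUdef
  have hUc : Continuous U := continuous_primitive hgl c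
  have hUg := integrableOn_mul_norm hg hU
  have hU2 := integrableOn_norm_sq hU
  have hF : Tendsto (fun X => ∫ x in Ioi X, 2 * (‖U x‖ * ‖g x‖)) atTop (𝓝 0) := by
    have h1 := intervalIntegral_tendsto_integral_Ioi 0 (hUg.const_mul 2) tendsto_id
    have h2 := (tendsto_const_nhds (x := ∫ x in Ioi (0:ℝ), 2 * (‖U x‖ * ‖g x‖))).sub h1
    rw [sub_self] at h2
    refine h2.congr' ?_
    filter_upwards [eventually_ge_atTop 0] with X hX
    rw [id, ← intervalIntegral.integral_Ioi_sub_Ioi (hUg.const_mul 2) hX, sub_sub_cancel]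
  have hsq : Tendsto (fun x => ‖U x‖ ^ 2) atTop (𝓝 0) := by
    rw [Metric.tendsto_atTop]
    intro ε hε
    obtain ⟨X, hX⟩ := eventually_atTop.1 ((tendsto_order.1 hF).2 (ε / 2) (by positivity))
    -- Otherwise `‖U‖ ^ 2 ≥ ε / 2` on a whole half-line, against integrability. Beyond `X0` the
    -- growth of `‖U‖ ^ 2` is bounded by the tail of `∫ 2 ‖U‖ ‖g‖`.
    obtain ⟨X0, hX0, hsmall⟩ : ∃ X0, max X 0 < X0 ∧ ‖U X0‖ ^ 2 < ε / 2 := by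
      by_contra! hcon
      have hi : IntegrableOn (fun _ : ℝ => ε / 2) (Ioi (max X 0)) := by
        refine (hU2.mono_set (Ioi_subset_Ioi (le_max_right _ _))).mono'
          aestronglyMeasurable_const ?_
        rw [ae_restrict_iff' measurableSet_Ioi]
        refine ae_of_all _ fun x hx => ?_
        rw [Real.norm_of_nonneg (by positivity)]
        exact hcon x hx
      rw [integrableOn_const_iff] at hi
      rcases hi with h | h
      · rw [enorm_eq_zero] at h; linarith
      · simp at h
    refine ⟨X0, fun y hy => ?_⟩
    have hpos : 0 ≤ X0 := (le_max_right X 0).trans hX0.le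
    have hch := abs_comp_sub_le_integral (r := fun x => ‖U x‖) (ρ := fun x => ‖g x‖)
      (H := fun t => t ^ 2) (w := fun t => 2 * t) hUc.norm (locallyIntegrable_norm hgl) (fun _ => norm_nonneg _)
      (fun x y hxy => abs_norm_primitive_sub_le hgl hxy) (by fun_prop)
      (fun t => by simpa using hasDerivAt_pow 2 t) hy
    have hle : ∫ t in X0..y, |2 * ‖U t‖| * ‖g t‖ ≤ ∫ x in Ioi X0, 2 * (‖U x‖ * ‖g x‖) := by
      rw [intervalIntegral.integral_of_le hy]
      have e : ∀ t, |2 * ‖U t‖| * ‖g t‖ = 2 * (‖U t‖ * ‖g t‖) := fun t => by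
        rw [abs_of_nonneg (by positivity)]; ring
      simp only [e]
      refine setIntegral_mono_set (IntegrableOn.mono_set (hUg.const_mul 2) (Ioi_subset_Ioi hpos))
        (ae_of_all _ fun x => by positivity) (Eventually.of_forall fun x hx => hx.1)
    have h2 := hX X0 ((le_max_left X 0).trans hX0.le)
    have h3 := (abs_le.1 hch).2
    rw [dist_zero_right, Real.norm_of_nonneg (by positivity)]
    linarith
  have := hsq.sqrt
  simpa [Real.sqrt_sq] using this

end Primitive

/-! ### The homoclinic orbit and the lower bound for the energy. -/

/-- The slope `√(2G(t))` of the homoclinic orbit of `u'' = ω u - u ^ p`. -/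
noncomputable def orbitSlope (p ω t : ℝ) : ℝ := t * √(ω - 2 / (p + 1) * t ^ (p - 1))

/-- The primitive of `orbitSlope` that vanishes at `0`. -/
noncomputable def orbitPrimitive (p ω t : ℝ) : ℝ := ∫ s in (0 : ℝ)..t, orbitSlope p ω s

variable {p ω : ℝ}

theorem continuous_orbitSlope (hp : 1 < p) : Continuous (orbitSlope p ω) := by
  have : Continuous fun t : ℝ => t ^ (p - 1) := Real.continuous_rpow_const (by linarith)
  unfold orbitSlope
  fun_prop

theorem orbitSlope_nonneg {t : ℝ} (ht : 0 ≤ t) : 0 ≤ orbitSlope p ω t :=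
  mul_nonneg ht (Real.sqrt_nonneg _)

theorem hasDerivAt_orbitPrimitive (hp : 1 < p) (t : ℝ) :
    HasDerivAt (orbitPrimitive p ω) (orbitSlope p ω t) t :=
  ((continuous_orbitSlope hp).integral_hasStrictDerivAt 0 t).hasDerivAt

theorem continuous_orbitPrimitive (hp : 1 < p) : Continuous (orbitPrimitive p ω) :=
  continuous_iff_continuousAt.2 fun t => (hasDerivAt_orbitPrimitive hp t).continuousAt

@[simp]
theorem orbitPrimitive_zero : orbitPrimitive p ω 0 = 0 := intervalIntegral.integral_same

theorem orbitPrimitive_sub (hp : 1 < p) (s t : ℝ) :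
    orbitPrimitive p ω t - orbitPrimitive p ω s = ∫ x in s..t, orbitSlope p ω x :=
  intervalIntegral.integral_interval_sub_left
    ((continuous_orbitSlope hp).intervalIntegrable _ _)
    ((continuous_orbitSlope hp).intervalIntegrable _ _)

theorem orbitPrimitive_mono (hp : 1 < p) {s t : ℝ} (hs : 0 ≤ s) (hst : s ≤ t) :
    orbitPrimitive p ω s ≤ orbitPrimitive p ω t := by
  rw [← sub_nonneg, orbitPrimitive_sub hp]
  exact intervalIntegral.integral_nonneg hst fun x hx => orbitSlope_nonneg (hs.trans hx.1)

/-- The bound `t ≤ M` keeps the radicand nonnegative; above `M` the real square root is `0` and the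
identity fails. -/
theorem orbitSlope_sq (hp : 1 < p) {t M : ℝ} (hM : 2 / (p + 1) * M ^ (p - 1) = ω) (ht : 0 ≤ t)
    (htM : t ≤ M) : orbitSlope p ω t ^ 2 = ω * t ^ 2 - 2 / (p + 1) * t ^ (p + 1) := by
  have h1 : t ^ (p - 1) ≤ M ^ (p - 1) := Real.rpow_le_rpow ht htM (by linarith)
  have h2 : 0 ≤ ω - 2 / (p + 1) * t ^ (p - 1) := by
    have := mul_le_mul_of_nonneg_left h1 (show 0 ≤ 2 / (p + 1) by positivity)
    linarith
  have h3 : t ^ (p + 1) = t ^ 2 * t ^ (p - 1) := by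
    rw [← Real.rpow_natCast, ← Real.rpow_add_of_nonneg ht (by norm_num) (by linarith)]
    congr 1; push_cast; ring
  rw [orbitSlope, mul_pow, Real.sq_sqrt h2, h3]; ring

theorem integrableOn_norm_rpow (hp : 1 < p) {U : ℝ → ℂ} {B : ℝ} (hUc : Continuous U)
    (hU : MemLp U 2 halfLine) (hB : ∀ x, 0 ≤ x → ‖U x‖ ≤ B) :
    IntegrableOn (fun x => ‖U x‖ ^ (p + 1)) (Ioi 0) := by
  have hc : Continuous fun x => ‖U x‖ ^ (p + 1) :=
    (Real.continuous_rpow_const (by linarith)).comp hUc.norm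
  refine ((integrableOn_norm_sq hU).const_mul (B ^ (p - 1))).mono' hc.aestronglyMeasurable ?_
  rw [ae_restrict_iff' measurableSet_Ioi]
  refine ae_of_all _ fun x hx => ?_
  have h3 : ‖U x‖ ^ (p + 1) = ‖U x‖ ^ (p - 1) * ‖U x‖ ^ 2 := by
    rw [← Real.rpow_natCast, ← Real.rpow_add_of_nonneg (norm_nonneg _) (by linarith) (by norm_num)]
    congr 1; push_cast; ring
  rw [Real.norm_of_nonneg (by positivity), h3]
  have := Real.rpow_le_rpow (norm_nonneg _) (hB x (le_of_lt hx)) (show 0 ≤ p - 1 by linarith)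
  gcongr

/-- The lower bound for the energy of a function bounded by the height `M` of the homoclinic
orbit. -/
theorem orbitPrimitive_le_energy (hp : 1 < p) {g : ℝ → ℂ} {c : ℂ} (hg : MemLp g 2 volume)
    (hU : MemLp (fun x => c + ∫ t in (0 : ℝ)..x, g t) 2 halfLine) {M : ℝ}
    (hM : 2 / (p + 1) * M ^ (p - 1) = ω)
    (hUM : ∀ x, 0 ≤ x → ‖c + ∫ t in (0 : ℝ)..x, g t‖ ≤ M) {x₀ : ℝ} (hx₀ : 0 ≤ x₀) :
    2 * orbitPrimitive p ω ‖c + ∫ t in (0 : ℝ)..x₀, g t‖ - orbitPrimitive p ω ‖c‖ ≤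
      1 / 2 * (∫ x in Ioi 0, ‖g x‖ ^ 2) +
        ω / 2 * (∫ x in Ioi 0, ‖c + ∫ t in (0 : ℝ)..x, g t‖ ^ 2) -
        1 / (p + 1) * ∫ x in Ioi 0, ‖c + ∫ t in (0 : ℝ)..x, g t‖ ^ (p + 1) := by
  have hgl := hg.locallyIntegrable (by norm_num)
  have hlim := tendsto_norm_primitive_zero hg hU
  have hdiff := fun x y (hxy : x ≤ y) => abs_norm_primitive_sub_le (c := c) hgl hxy
  have hU0 : c + ∫ t in (0 : ℝ)..0, g t = c := by simp
  set U : ℝ → ℂ := fun x => c + ∫ t in (0 : ℝ)..x, g t with hUdef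
  have hUc : Continuous U := continuous_primitive hgl c
  have iA : IntegrableOn (fun x => ‖g x‖ ^ 2) (Ioi 0) := integrableOn_norm_sq (hg.restrict _)
  have iB := integrableOn_norm_sq hU
  have iC := integrableOn_norm_rpow hp hUc hU hUM
  let w := orbitSlope p ω
  have hwc : Continuous w := continuous_orbitSlope hp
  let E : ℝ → ℝ := fun x => 1 / 2 * ‖g x‖ ^ 2 + ω / 2 * ‖U x‖ ^ 2 - 1 / (p + 1) * ‖U x‖ ^ (p + 1)
  have iE : IntegrableOn E (Ioi 0) :=
    ((iA.const_mul _).add (iB.const_mul _)).sub (iC.const_mul _)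
  have hEval : ∫ x in Ioi 0, E x = 1 / 2 * (∫ x in Ioi 0, ‖g x‖ ^ 2) +
        ω / 2 * (∫ x in Ioi 0, ‖U x‖ ^ 2) - 1 / (p + 1) * ∫ x in Ioi 0, ‖U x‖ ^ (p + 1) := by
    have i1 := iA.const_mul (1 / 2)
    have i2 := iB.const_mul (ω / 2)
    have i3 := iC.const_mul (1 / (p + 1))
    rw [← integral_const_mul, ← integral_const_mul, ← integral_const_mul, ← integral_add i1 i2]
    exact integral_sub (i1.add i2) i3
  -- The density is half a sum of two squares, hence at least their product.
  have hEw : ∀ x, 0 ≤ x → |w ‖U x‖| * ‖g x‖ ≤ E x := by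
    intro x hx
    have h1 := orbitSlope_sq hp hM (norm_nonneg (U x)) (hUM x hx)
    rw [abs_of_nonneg (orbitSlope_nonneg (norm_nonneg _))]
    have h2 := two_mul_le_add_sq (w ‖U x‖) ‖g x‖
    have h3 : E x = 1 / 2 * (w ‖U x‖ ^ 2 + ‖g x‖ ^ 2) := by
      simp only [E, w]; rw [h1]; ring
    rw [h3]; linarith
  have hE0 : ∀ x, 0 ≤ x → 0 ≤ E x := fun x hx =>
    (mul_nonneg (abs_nonneg _) (norm_nonneg _)).trans (hEw x hx)
  have hchain := fun {a b : ℝ} (hab : a ≤ b) => abs_comp_sub_le_integral (r := fun x => ‖U x‖)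
    (ρ := fun x => ‖g x‖) hUc.norm (locallyIntegrable_norm hgl) (fun _ => norm_nonneg _) hdiff hwc
    (hasDerivAt_orbitPrimitive hp) hab
  have hi : ∀ a b, IntervalIntegrable (fun t => |w ‖U t‖| * ‖g t‖) volume a b := fun a b =>
    (intervalIntegrable_of_locallyIntegrable (locallyIntegrable_norm hgl) a b).continuousOn_mul
      (hwc.comp hUc.norm).abs.continuousOn
  -- The variation of `orbitPrimitive` along `‖U‖` is counted on `[0, x₀]` and on `[x₀, Y]`
  -- separately, whence the factor `2`.
  have hY : ∀ Y, x₀ ≤ Y → 2 * orbitPrimitive p ω ‖U x₀‖ - orbitPrimitive p ω ‖c‖ -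
      orbitPrimitive p ω ‖U Y‖ ≤ ∫ x in Ioi 0, E x := by
    intro Y hxY
    have h1 := (abs_le.1 (hchain hx₀)).2
    have h2 := (abs_le.1 (hchain hxY)).1
    have h3 : ∫ t in (0 : ℝ)..Y, |w ‖U t‖| * ‖g t‖ ≤ ∫ x in Ioi 0, E x := by
      rw [intervalIntegral.integral_of_le (hx₀.trans hxY)]
      refine (setIntegral_mono_on ((hi 0 Y).1) (iE.mono_set fun x hx => hx.1) measurableSet_Ioc
        fun x hx => hEw x hx.1.le).trans ?_
      refine setIntegral_mono_set iE ?_ (Eventually.of_forall fun x hx => hx.1)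
      rw [EventuallyLE, ae_restrict_iff' measurableSet_Ioi]
      exact ae_of_all _ fun x hx => hE0 x (le_of_lt hx)
    rw [← intervalIntegral.integral_add_adjacent_intervals (hi 0 x₀) (hi x₀ Y)] at h3
    have h4 : U 0 = c := hU0
    simp only [h4] at h1
    linarith
  have hlimH : Tendsto (fun Y => 2 * orbitPrimitive p ω ‖U x₀‖ - orbitPrimitive p ω ‖c‖ -
      orbitPrimitive p ω ‖U Y‖) atTop
      (𝓝 (2 * orbitPrimitive p ω ‖U x₀‖ - orbitPrimitive p ω ‖c‖ - orbitPrimitive p ω 0)) :=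
    tendsto_const_nhds.sub (((continuous_orbitPrimitive hp).tendsto 0).comp hlim)
  rw [orbitPrimitive_zero, sub_zero] at hlimH
  rw [← hEval]
  refine le_of_tendsto hlimH ?_
  filter_upwards [eventually_ge_atTop x₀] with Y h using hY Y h

/-! ### The ground state level with Robin parameter, and the scaling argument. -/

variable {p ω γ : ℝ}

/-- The level of the action of the ground state on the half-line with Robin parameter `γ`, where
`M` is the height of the homoclinic orbit and `a` is the boundary value. -/
noncomputable def orbitLevel (p ω γ M a : ℝ) : ℝ :=
  if 0 ≤ γ then γ / 2 * a ^ 2 - orbitPrimitive p ω a + 2 * orbitPrimitive p ω M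
  else γ / 2 * a ^ 2 + orbitPrimitive p ω a

theorem mul_le_orbitSlope (hp : 1 < p) {a t : ℝ} (ha : γ ^ 2 = ω - 2 / (p + 1) * a ^ (p - 1))
    (ht : 0 ≤ t) (hta : t ≤ a) : γ * t ≤ orbitSlope p ω t := by
  rw [orbitSlope, mul_comm]
  refine mul_le_mul_of_nonneg_left (Real.le_sqrt_of_sq_le ?_) ht
  have := mul_le_mul_of_nonneg_left (Real.rpow_le_rpow ht hta (show 0 ≤ p - 1 by linarith))
    (show 0 ≤ 2 / (p + 1) by positivity)
  linarith

/-- No upper bound on `t` is needed: past the height of the orbit the square root is `0`. -/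
theorem orbitSlope_le_mul (hp : 1 < p) (hγ : 0 ≤ γ) {a t : ℝ}
    (ha : γ ^ 2 = ω - 2 / (p + 1) * a ^ (p - 1)) (ha0 : 0 ≤ a) (hat : a ≤ t) :
    orbitSlope p ω t ≤ γ * t := by
  rw [orbitSlope, mul_comm]
  refine mul_le_mul_of_nonneg_right (Real.sqrt_le_iff.2 ⟨hγ, ?_⟩) (ha0.trans hat)
  have := mul_le_mul_of_nonneg_left (Real.rpow_le_rpow ha0 hat (show 0 ≤ p - 1 by linarith))
    (show 0 ≤ 2 / (p + 1) by positivity)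
  linarith

theorem integral_mul_id (a b : ℝ) :
    ∫ t in a..b, γ * t = γ / 2 * b ^ 2 - γ / 2 * a ^ 2 := by
  rw [intervalIntegral.integral_const_mul, integral_id]; ring

/-- The derivative `γ t - orbitSlope p ω t` of the function compared is nonpositive on `[0, a]`, and
nonnegative beyond `a` when `γ ≥ 0`. So `a` is the minimum on the whole half-line, or only on `[0,
a]` if `γ < 0`. -/
theorem quad_sub_orbitPrimitive_le (hp : 1 < p) {a b : ℝ}
    (ha : γ ^ 2 = ω - 2 / (p + 1) * a ^ (p - 1)) (ha0 : 0 ≤ a) (hb0 : 0 ≤ b)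
    (h : 0 ≤ γ ∨ b ≤ a) :
    γ / 2 * a ^ 2 - orbitPrimitive p ω a ≤ γ / 2 * b ^ 2 - orbitPrimitive p ω b := by
  have i1 : ∀ x y, IntervalIntegrable (fun t : ℝ => γ * t) volume x y := fun x y =>
    (by fun_prop : Continuous fun t : ℝ => γ * t).intervalIntegrable _ _
  have i2 : ∀ x y, IntervalIntegrable (orbitSlope p ω) volume x y := fun x y =>
    (continuous_orbitSlope hp).intervalIntegrable _ _
  rcases le_total b a with hba | hab
  · have h1 := intervalIntegral.integral_mono_on hba (i1 b a) (i2 b a) fun t ht =>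
      mul_le_orbitSlope hp ha (hb0.trans ht.1) ht.2
    rw [integral_mul_id, ← orbitPrimitive_sub hp] at h1
    linarith
  · rcases h with hγ | hba
    · have h1 := intervalIntegral.integral_mono_on hab (i2 a b) (i1 a b) fun t ht =>
        orbitSlope_le_mul hp hγ ha ha0 ht.1
      rw [integral_mul_id, ← orbitPrimitive_sub hp] at h1
      linarith
    · rw [le_antisymm hba hab]

/-- `orbitPrimitive_le_energy` for the multiples of a function. -/
theorem orbitPrimitive_le_energy_smul (hp : 1 < p) {g : ℝ → ℂ} {c : ℂ} (hg : MemLp g 2 volume)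
    (hU : MemLp (fun x => c + ∫ t in (0 : ℝ)..x, g t) 2 halfLine) {M s : ℝ} (hs : 0 < s)
    (hM : 2 / (p + 1) * M ^ (p - 1) = ω)
    (hUM : ∀ x, 0 ≤ x → s * ‖c + ∫ t in (0 : ℝ)..x, g t‖ ≤ M) {x₀ : ℝ} (hx₀ : 0 ≤ x₀) :
    2 * orbitPrimitive p ω (s * ‖c + ∫ t in (0 : ℝ)..x₀, g t‖) - orbitPrimitive p ω (s * ‖c‖) ≤
      s ^ 2 / 2 * ((∫ x in Ioi 0, ‖g x‖ ^ 2) +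
        ω * (∫ x in Ioi 0, ‖c + ∫ t in (0 : ℝ)..x, g t‖ ^ 2)) -
        s ^ (p + 1) / (p + 1) * ∫ x in Ioi 0, ‖c + ∫ t in (0 : ℝ)..x, g t‖ ^ (p + 1) := by
  have e : ∀ x : ℝ, (s : ℂ) * c + ∫ t in (0 : ℝ)..x, (s : ℂ) * g t =
      (s : ℂ) * (c + ∫ t in (0 : ℝ)..x, g t) := fun x => by
    rw [intervalIntegral.integral_const_mul, mul_add]
  have hn : ∀ z : ℂ, ‖(s : ℂ) * z‖ = s * ‖z‖ := fun z => by
    rw [norm_mul, Complex.norm_real, Real.norm_of_nonneg hs.le]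
  have hU' : MemLp (fun x => (s : ℂ) * c + ∫ t in (0 : ℝ)..x, (s : ℂ) * g t) 2 halfLine := by
    simp only [e]; exact hU.const_mul _
  have := orbitPrimitive_le_energy (M := M) (x₀ := x₀) hp (hg.const_mul (s : ℂ)) hU' hM
    (fun x hx => by rw [e, hn]; exact hUM x hx) hx₀
  simp only [e, hn, mul_pow, Real.mul_rpow hs.le (norm_nonneg _), integral_const_mul] at this
  refine this.trans_eq ?_
  ring

theorem exists_isMax_norm_primitive {g : ℝ → ℂ} {c : ℂ} (hg : MemLp g 2 volume)
    (hU : MemLp (fun x => c + ∫ t in (0 : ℝ)..x, g t) 2 halfLine) {x₁ : ℝ} (hx₁ : 0 ≤ x₁)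
    (h1 : c + ∫ t in (0 : ℝ)..x₁, g t ≠ 0) :
    ∃ x₀, 0 ≤ x₀ ∧ ∀ x, 0 ≤ x →
      ‖c + ∫ t in (0 : ℝ)..x, g t‖ ≤ ‖c + ∫ t in (0 : ℝ)..x₀, g t‖ := by
  have hlim := tendsto_norm_primitive_zero hg hU
  have hc := (continuous_primitive (hg.locallyIntegrable (by norm_num)) c).norm
  obtain ⟨X, hX⟩ := eventually_atTop.1 ((tendsto_order.1 hlim).2 _ (norm_pos_iff.2 h1))
  obtain ⟨x₀, hx₀, hmax⟩ := (isCompact_Icc (a := (0 : ℝ)) (b := max X x₁)).exists_isMaxOn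
    ⟨x₁, hx₁, le_max_right _ _⟩ hc.continuousOn
  refine ⟨x₀, hx₀.1, fun x hx => ?_⟩
  rcases le_total x (max X x₁) with h | h
  · exact hmax ⟨hx, h⟩
  · exact (hX x ((le_max_left _ _).trans h)).le.trans (hmax ⟨hx₁, le_max_right _ _⟩)

/-- Every nonzero function of `H¹` has a multiple whose action is at least the level of the ground
state. -/
theorem exists_orbitLevel_le_action_smul (hp : 1 < p) {g : ℝ → ℂ} {c : ℂ} (hg : MemLp g 2 volume)
    (hU : MemLp (fun x => c + ∫ t in (0 : ℝ)..x, g t) 2 halfLine) {x₁ : ℝ} (hx₁ : 0 ≤ x₁)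
    (h1 : c + ∫ t in (0 : ℝ)..x₁, g t ≠ 0) {M a : ℝ} (hM : 2 / (p + 1) * M ^ (p - 1) = ω)
    (ha : γ ^ 2 = ω - 2 / (p + 1) * a ^ (p - 1)) (ha0 : 0 < a) (haM : a ≤ M) :
    ∃ s, 0 < s ∧ orbitLevel p ω γ M a ≤
      s ^ 2 / 2 * ((∫ x in Ioi 0, ‖g x‖ ^ 2) + γ * ‖c‖ ^ 2 +
        ω * (∫ x in Ioi 0, ‖c + ∫ t in (0 : ℝ)..x, g t‖ ^ 2)) -
        s ^ (p + 1) / (p + 1) * ∫ x in Ioi 0, ‖c + ∫ t in (0 : ℝ)..x, g t‖ ^ (p + 1) := by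
  obtain ⟨x₀, hx₀, hmax⟩ := exists_isMax_norm_primitive hg hU hx₁ h1
  have key := fun {s : ℝ} (hs : 0 < s) hUM =>
    orbitPrimitive_le_energy_smul hp hg hU (M := M) hs hM hUM hx₀
  have hcm : ‖c‖ ≤ ‖c + ∫ t in (0 : ℝ)..x₀, g t‖ := by simpa using hmax 0 le_rfl
  have hpos : 0 < ‖c + ∫ t in (0 : ℝ)..x₀, g t‖ := (norm_pos_iff.2 h1).trans_le (hmax x₁ hx₁)
  set m := ‖c + ∫ t in (0 : ℝ)..x₀, g t‖ with hm
  have hM0 : 0 < M := ha0.trans_le haM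
  have hs : 0 < M / m := div_pos hM0 hpos
  have hsm : M / m * m = M := div_mul_cancel₀ _ hpos.ne'
  -- Scaling the maximum to `M` works unless `γ < 0` and the scaled boundary value exceeds `a`. In
  -- that case the boundary value is scaled to `a`, a smaller factor, so the bound by `M` persists.
  by_cases hcase : 0 ≤ γ ∨ M / m * ‖c‖ ≤ a
  · refine ⟨M / m, hs, ?_⟩
    have k := key hs fun x hx => (mul_le_mul_of_nonneg_left (hmax x hx) hs.le).trans_eq hsm
    rw [hsm] at k
    have q := quad_sub_orbitPrimitive_le hp ha ha0.le (by positivity) hcase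
    have hle : orbitLevel p ω γ M a ≤
        γ / 2 * a ^ 2 - orbitPrimitive p ω a + 2 * orbitPrimitive p ω M := by
      rw [orbitLevel]
      split_ifs
      · exact le_rfl
      · have := orbitPrimitive_mono (ω := ω) hp ha0.le haM
        linarith
    rw [mul_pow] at q
    linarith
  · push Not at hcase
    obtain ⟨hγ, hca⟩ := hcase
    have hc0 : 0 < ‖c‖ := by
      by_contra h
      rw [le_antisymm (not_lt.1 h) (norm_nonneg c), mul_zero] at hca
      linarith
    have hsc : a / ‖c‖ * ‖c‖ = a := div_mul_cancel₀ _ hc0.ne'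
    have hs' : 0 < a / ‖c‖ := div_pos ha0 hc0
    have hss : a / ‖c‖ ≤ M / m := by rw [div_le_iff₀ hc0]; exact hca.le
    refine ⟨a / ‖c‖, hs', ?_⟩
    have k := key hs' fun x hx =>
      (mul_le_mul hss (hmax x hx) (norm_nonneg _) hs.le).trans_eq hsm
    rw [hsc] at k
    have ham : a ≤ a / ‖c‖ * m := by
      conv_lhs => rw [← hsc]
      exact mul_le_mul_of_nonneg_left hcm hs'.le
    have h2 := orbitPrimitive_mono (ω := ω) hp ha0.le ham
    have h3 : (a / ‖c‖) ^ 2 * ‖c‖ ^ 2 = a ^ 2 := by rw [← mul_pow, hsc]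
    rw [orbitLevel, if_neg (not_le.2 hγ)]
    have h4 : (a / ‖c‖) ^ 2 / 2 * (γ * ‖c‖ ^ 2) = γ / 2 * a ^ 2 := by rw [← h3]; ring
    linarith

/-- Bernoulli's inequality for `(1 + (s ^ 2 - 1)) ^ ((p + 1) / 2)`. -/
theorem sq_sub_rpow_le (hp : 1 < p) {s : ℝ} (hs : 0 < s) :
    s ^ 2 / 2 - s ^ (p + 1) / (p + 1) ≤ 1 / 2 - 1 / (p + 1) := by
  have h := one_add_mul_self_le_rpow_one_add (s := s ^ 2 - 1) (by nlinarith [sq_nonneg s])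
    (p := (p + 1) / 2) (by linarith)
  have e : (1 + (s ^ 2 - 1)) ^ ((p + 1) / 2) = s ^ (p + 1) := by
    rw [add_sub_cancel, ← Real.rpow_natCast, ← Real.rpow_mul hs.le]
    congr 1; push_cast; ring
  rw [e] at h
  have hp1 : 0 < p + 1 := by linarith
  have : (1 + (p + 1) / 2 * (s ^ 2 - 1)) / (p + 1) ≤ s ^ (p + 1) / (p + 1) := by gcongr
  have e2 : (1 + (p + 1) / 2 * (s ^ 2 - 1)) / (p + 1) = 1 / (p + 1) + (s ^ 2 - 1) / 2 := by
    field_simp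
  linarith

/-- On the Nehari manifold the action is at least the level of the ground state. -/
theorem orbitLevel_le_of_nehari (hp : 1 < p) {g : ℝ → ℂ} {c : ℂ} (hg : MemLp g 2 volume)
    (hU : MemLp (fun x => c + ∫ t in (0 : ℝ)..x, g t) 2 halfLine) {x₁ : ℝ} (hx₁ : 0 ≤ x₁)
    (h1 : c + ∫ t in (0 : ℝ)..x₁, g t ≠ 0) {M a : ℝ} (hM : 2 / (p + 1) * M ^ (p - 1) = ω)
    (ha : γ ^ 2 = ω - 2 / (p + 1) * a ^ (p - 1)) (ha0 : 0 < a) (haM : a ≤ M)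
    (hN : (∫ x in Ioi 0, ‖g x‖ ^ 2) + γ * ‖c‖ ^ 2 +
        ω * (∫ x in Ioi 0, ‖c + ∫ t in (0 : ℝ)..x, g t‖ ^ 2) =
      ∫ x in Ioi 0, ‖c + ∫ t in (0 : ℝ)..x, g t‖ ^ (p + 1)) :
    orbitLevel p ω γ M a ≤
      (1 / 2 - 1 / (p + 1)) * ∫ x in Ioi 0, ‖c + ∫ t in (0 : ℝ)..x, g t‖ ^ (p + 1) := by
  obtain ⟨s, hs, h⟩ := exists_orbitLevel_le_action_smul hp hg hU hx₁ h1 hM ha ha0 haM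
  rw [hN, ← sub_mul] at h
  refine h.trans (mul_le_mul_of_nonneg_right (sq_sub_rpow_le hp hs) ?_)
  exact integral_nonneg fun x => by positivity

/-! ### The soliton: first integral, integrability and energy. -/

/-- The translate of the soliton whose maximum lies at `2 τ / ((p - 1) √ω)`. -/
noncomputable def soliton (p ω τ x : ℝ) : ℝ :=
  ((p + 1) * ω / 2 * (1 / Real.cosh ((p - 1) * √ω / 2 * x - τ)) ^ 2) ^ (1 / (p - 1))

/-- The height of the soliton. -/
noncomputable def solitonHeight (p ω : ℝ) : ℝ := ((p + 1) * ω / 2) ^ (1 / (p - 1))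

variable {p ω τ : ℝ}

theorem soliton_base_pos (hp : 1 < p) (hω : 0 < ω) (y : ℝ) :
    0 < (p + 1) * ω / 2 * (1 / Real.cosh y) ^ 2 := by
  have := Real.cosh_pos y
  positivity

theorem soliton_pos (hp : 1 < p) (hω : 0 < ω) (x : ℝ) : 0 < soliton p ω τ x :=
  Real.rpow_pos_of_pos (soliton_base_pos hp hω _) _

theorem soliton_rpow (hp : 1 < p) (hω : 0 < ω) (x : ℝ) :
    soliton p ω τ x ^ (p - 1) =
      (p + 1) * ω / 2 * (1 / Real.cosh ((p - 1) * √ω / 2 * x - τ)) ^ 2 := by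
  rw [soliton, ← Real.rpow_mul (soliton_base_pos hp hω _).le, one_div_mul_cancel (by linarith),
    Real.rpow_one]

theorem solitonHeight_rpow (hp : 1 < p) (hω : 0 < ω) :
    2 / (p + 1) * solitonHeight p ω ^ (p - 1) = ω := by
  rw [solitonHeight, ← Real.rpow_mul (by positivity), one_div_mul_cancel (by linarith),
    Real.rpow_one]
  field_simp

theorem one_div_cosh_sq (y : ℝ) : (1 / Real.cosh y) ^ 2 = 1 - Real.tanh y ^ 2 := by
  have h := Real.cosh_pos y
  rw [Real.tanh_eq_sinh_div_cosh]
  field_simp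
  rw [Real.cosh_sq]; ring

theorem soliton_rpow_eq_tanh (hp : 1 < p) (hω : 0 < ω) (x : ℝ) :
    2 / (p + 1) * soliton p ω τ x ^ (p - 1) =
      ω * (1 - Real.tanh ((p - 1) * √ω / 2 * x - τ) ^ 2) := by
  rw [soliton_rpow hp hω, one_div_cosh_sq]
  field_simp

theorem soliton_le_height (hp : 1 < p) (hω : 0 < ω) (x : ℝ) :
    soliton p ω τ x ≤ solitonHeight p ω := by
  refine Real.rpow_le_rpow (soliton_base_pos hp hω _).le ?_
    (one_div_nonneg.2 (by linarith))
  refine mul_le_of_le_one_right (by positivity) ?_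
  rw [one_div_cosh_sq]
  linarith [sq_nonneg (Real.tanh ((p - 1) * √ω / 2 * x - τ))]

theorem soliton_eq_height {x : ℝ} (hx : (p - 1) * √ω / 2 * x = τ) :
    soliton p ω τ x = solitonHeight p ω := by
  simp [soliton, solitonHeight, hx]

theorem hasDerivAt_real_tanh (y : ℝ) : HasDerivAt Real.tanh ((1 / Real.cosh y) ^ 2) y := by
  have h := (Real.hasDerivAt_sinh y).div (Real.hasDerivAt_cosh y) (Real.cosh_pos y).ne'
  have e : Real.tanh = fun y => Real.sinh y / Real.cosh y :=
    funext Real.tanh_eq_sinh_div_cosh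
  rw [e]
  refine h.congr_deriv ?_
  have := Real.cosh_sq y
  rw [one_div, inv_pow, div_eq_mul_inv, ← pow_two, ← pow_two, this]
  ring

theorem hasDerivAt_soliton (hp : 1 < p) (hω : 0 < ω) (x : ℝ) :
    HasDerivAt (soliton p ω τ)
      (-(√ω * Real.tanh ((p - 1) * √ω / 2 * x - τ)) * soliton p ω τ x) x := by
  set y := (p - 1) * √ω / 2 * x - τ with hy
  have hc := Real.cosh_pos y
  have h1 : HasDerivAt (fun x => (p - 1) * √ω / 2 * x - τ) ((p - 1) * √ω / 2) x := by
    simpa using ((hasDerivAt_id x).const_mul ((p - 1) * √ω / 2)).sub_const τ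
  have h2 : HasDerivAt (fun x => Real.cosh ((p - 1) * √ω / 2 * x - τ))
      (Real.sinh y * ((p - 1) * √ω / 2)) x := h1.cosh
  have h3 := ((h2.inv hc.ne').pow 2).const_mul ((p + 1) * ω / 2)
  have hb := soliton_base_pos hp hω y
  have h4 : HasDerivAt (soliton p ω τ) _ x :=
    HasDerivAt.rpow_const (p := 1 / (p - 1)) (h3.congr_of_eventuallyEq
      (f₁ := fun x => (p + 1) * ω / 2 * (1 / Real.cosh ((p - 1) * √ω / 2 * x - τ)) ^ 2)
      (Eventually.of_forall fun x => by simp)) (Or.inl hb.ne')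
  refine h4.congr_deriv ?_
  rw [Real.rpow_sub_one hb.ne']
  change _ = _ * ((p + 1) * ω / 2 * (1 / Real.cosh y) ^ 2) ^ (1 / (p - 1))
  generalize ((p + 1) * ω / 2 * (1 / Real.cosh y) ^ 2) ^ (1 / (p - 1)) = P
  rw [Real.tanh_eq_sinh_div_cosh]
  have : p - 1 ≠ 0 := by linarith
  have : p + 1 ≠ 0 := by linarith
  simp only [Pi.inv_apply, ← hy, Nat.cast_ofNat, Nat.add_one_sub_one, pow_one]
  field_simp

theorem continuous_soliton (hp : 1 < p) (hω : 0 < ω) : Continuous (soliton p ω τ) :=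
  continuous_iff_continuousAt.2 fun x => (hasDerivAt_soliton hp hω x).continuousAt

theorem continuous_real_tanh : Continuous Real.tanh :=
  continuous_iff_continuousAt.2 fun x => (hasDerivAt_real_tanh x).continuousAt

theorem tanh_sq_le_one (y : ℝ) : Real.tanh y ^ 2 ≤ 1 := by
  have := one_div_cosh_sq y
  have h2 := sq_nonneg (1 / Real.cosh y)
  linarith

theorem orbitSlope_soliton (hp : 1 < p) (hω : 0 < ω) (x : ℝ) :
    orbitSlope p ω (soliton p ω τ x) =
      √ω * |Real.tanh ((p - 1) * √ω / 2 * x - τ)| * soliton p ω τ x := by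
  rw [orbitSlope, soliton_rpow_eq_tanh hp hω]
  have : ω - ω * (1 - Real.tanh ((p - 1) * √ω / 2 * x - τ) ^ 2) =
    ω * Real.tanh ((p - 1) * √ω / 2 * x - τ) ^ 2 := by ring
  rw [this, Real.sqrt_mul hω.le, Real.sqrt_sq_eq_abs]; ring

/-- From `sech y ≤ 2 exp (-y)`; the power `2 / (p - 1)` turns the rate `(p - 1) √ω / 2` into `√ω`.
-/
theorem soliton_le_exp (hp : 1 < p) (hω : 0 < ω) (x : ℝ) :
    soliton p ω τ x ≤
      (4 * ((p + 1) * ω / 2) * Real.exp (2 * τ)) ^ (1 / (p - 1)) * Real.exp (-√ω * x) := by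
  set y := (p - 1) * √ω / 2 * x - τ with hy
  have hs : 1 / Real.cosh y ≤ 2 * Real.exp (-y) := by
    rw [div_le_iff₀ (Real.cosh_pos y), Real.cosh_eq]
    have h1 : Real.exp (-y) * Real.exp y = 1 := by rw [← Real.exp_add]; simp
    nlinarith [sq_nonneg (Real.exp (-y))]
  have hs2 : (1 / Real.cosh y) ^ 2 ≤ 4 * Real.exp (2 * τ) * Real.exp (-((p - 1) * √ω * x)) := by
    have h0 : 0 ≤ 1 / Real.cosh y := by have := Real.cosh_pos y; positivity
    refine (pow_le_pow_left₀ h0 hs 2).trans_eq ?_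
    rw [mul_pow, ← Real.exp_nat_mul, mul_assoc 4, ← Real.exp_add]
    norm_num
    rw [hy]; ring
  have hk : 0 < p - 1 := by linarith
  calc soliton p ω τ x
      ≤ (4 * ((p + 1) * ω / 2) * Real.exp (2 * τ) * Real.exp (-((p - 1) * √ω * x))) ^
          (1 / (p - 1)) := by
        refine Real.rpow_le_rpow (soliton_base_pos hp hω _).le ?_ (by positivity)
        refine (mul_le_mul_of_nonneg_left hs2 (by positivity)).trans_eq ?_
        ring
    _ = _ := by
        rw [Real.mul_rpow (by positivity) (Real.exp_pos _).le, ← Real.exp_mul]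
        congr 2
        field_simp

theorem tendsto_soliton (hp : 1 < p) (hω : 0 < ω) :
    Tendsto (soliton p ω τ) atTop (𝓝 0) := by
  have hs : 0 < √ω := Real.sqrt_pos.2 hω
  refine squeeze_zero (fun x => (soliton_pos hp hω x).le) (fun x => soliton_le_exp hp hω x) ?_
  have h : Tendsto (fun x : ℝ => Real.exp (-√ω * x)) atTop (𝓝 0) :=
    Real.tendsto_exp_atBot.comp ((tendsto_const_mul_atBot_of_neg (by linarith)).2 tendsto_id)
  simpa using h.const_mul ((4 * ((p + 1) * ω / 2) * Real.exp (2 * τ)) ^ (1 / (p - 1)))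

theorem integrableOn_soliton_sq (hp : 1 < p) (hω : 0 < ω) :
    IntegrableOn (fun x => soliton p ω τ x ^ 2) (Ioi 0) := by
  have hs : 0 < √ω := Real.sqrt_pos.2 hω
  set B := (4 * ((p + 1) * ω / 2) * Real.exp (2 * τ)) ^ (1 / (p - 1))
  refine Integrable.mono' ((exp_neg_integrableOn_Ioi 0 (show 0 < 2 * √ω by positivity)).const_mul
    (B ^ 2)) ((continuous_soliton hp hω).pow 2).aestronglyMeasurable (ae_of_all _ fun x => ?_)
  rw [Real.norm_of_nonneg (by positivity)]
  refine (pow_le_pow_left₀ (soliton_pos hp hω x).le (soliton_le_exp hp hω x) 2).trans_eq ?_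
  rw [mul_pow, ← Real.exp_nat_mul]
  congr 2
  push_cast; ring

/-- The derivative of the soliton. -/
noncomputable def solitonDeriv (p ω τ x : ℝ) : ℝ :=
  -(√ω * Real.tanh ((p - 1) * √ω / 2 * x - τ)) * soliton p ω τ x

theorem continuous_solitonDeriv (hp : 1 < p) (hω : 0 < ω) : Continuous (solitonDeriv p ω τ) := by
  have h1 := continuous_soliton (τ := τ) hp hω
  have h2 := continuous_real_tanh
  unfold solitonDeriv
  fun_prop

theorem solitonDeriv_sq (hω : 0 < ω) (x : ℝ) : solitonDeriv p ω τ x ^ 2 =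
    ω * Real.tanh ((p - 1) * √ω / 2 * x - τ) ^ 2 * soliton p ω τ x ^ 2 := by
  rw [solitonDeriv, mul_pow, neg_sq, mul_pow, Real.sq_sqrt hω.le]

/-- The zero-energy first integral of `φ'' = ω φ - φ ^ p`. -/
theorem soliton_rpow_add_one (hp : 1 < p) (hω : 0 < ω) (x : ℝ) :
    2 / (p + 1) * soliton p ω τ x ^ (p + 1) = ω * soliton p ω τ x ^ 2 - solitonDeriv p ω τ x ^ 2 := by
  have h3 : soliton p ω τ x ^ (p + 1) = soliton p ω τ x ^ 2 * soliton p ω τ x ^ (p - 1) := by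
    rw [← Real.rpow_natCast, ← Real.rpow_add (soliton_pos hp hω x)]
    congr 1; push_cast; ring
  rw [h3, mul_left_comm, soliton_rpow_eq_tanh hp hω, solitonDeriv_sq hω]
  ring

theorem integrableOn_solitonDeriv_sq (hp : 1 < p) (hω : 0 < ω) :
    IntegrableOn (fun x => solitonDeriv p ω τ x ^ 2) (Ioi 0) := by
  refine Integrable.mono' ((integrableOn_soliton_sq hp hω (τ := τ)).const_mul ω)
    ((continuous_solitonDeriv hp hω).pow 2).aestronglyMeasurable (ae_of_all _ fun x => ?_)
  rw [Real.norm_of_nonneg (by positivity), solitonDeriv_sq hω]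
  have := tanh_sq_le_one ((p - 1) * √ω / 2 * x - τ)
  have h2 : ω * Real.tanh ((p - 1) * √ω / 2 * x - τ) ^ 2 ≤ ω := mul_le_of_le_one_right hω.le this
  gcongr

theorem integrableOn_soliton_rpow (hp : 1 < p) (hω : 0 < ω) :
    IntegrableOn (fun x => soliton p ω τ x ^ (p + 1)) (Ioi 0) := by
  have h := ((integrableOn_soliton_sq hp hω (τ := τ)).const_mul ω).sub
    (integrableOn_solitonDeriv_sq hp hω (τ := τ))
  refine (Integrable.const_mul h ((p + 1) / 2)).congr (ae_of_all _ fun x => ?_)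
  simp only [Pi.sub_apply]
  rw [← soliton_rpow_add_one hp hω]
  field_simp

/-- The virial identity `∫ φ'² + ω φ² - φ ^ (p + 1) = -φ(0) φ'(0)`. -/
theorem soliton_nehari (hp : 1 < p) (hω : 0 < ω) :
    (∫ x in Ioi 0, solitonDeriv p ω τ x ^ 2) + ω * (∫ x in Ioi 0, soliton p ω τ x ^ 2) -
      ∫ x in Ioi 0, soliton p ω τ x ^ (p + 1) = -(√ω * Real.tanh τ) * soliton p ω τ 0 ^ 2 := by
  have iA := integrableOn_solitonDeriv_sq hp hω (τ := τ)
  have iB := (integrableOn_soliton_sq hp hω (τ := τ)).const_mul ω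
  have iC := integrableOn_soliton_rpow hp hω (τ := τ)
  -- `(φ' φ)' = φ'² + φ φ''`, with `φ φ'' = ω φ² - φ ^ (p + 1)`.
  have hd : ∀ x ∈ Ici (0 : ℝ), HasDerivAt (fun x => solitonDeriv p ω τ x * soliton p ω τ x)
      (solitonDeriv p ω τ x ^ 2 + ω * soliton p ω τ x ^ 2 - soliton p ω τ x ^ (p + 1)) x := by
    intro x _
    have h1 := hasDerivAt_soliton (τ := τ) hp hω x
    have h2 : HasDerivAt (fun x => (p - 1) * √ω / 2 * x - τ) ((p - 1) * √ω / 2) x := by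
      simpa using ((hasDerivAt_id x).const_mul ((p - 1) * √ω / 2)).sub_const τ
    have h3 := ((((hasDerivAt_real_tanh _).comp x h2).const_mul √ω).neg.mul h1).mul h1
    refine h3.congr_deriv ?_
    have e := soliton_rpow_add_one (τ := τ) hp hω x
    have e' : soliton p ω τ x ^ (p + 1) =
        (p + 1) / 2 * (ω * soliton p ω τ x ^ 2 - solitonDeriv p ω τ x ^ 2) := by
      rw [← e]; field_simp
    rw [e', solitonDeriv_sq hω, one_div_cosh_sq]
    have hs := Real.mul_self_sqrt hω.le
    simp only [Function.comp, Pi.mul_apply, Pi.neg_apply]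
    generalize Real.tanh ((p - 1) * √ω / 2 * x - τ) = t
    generalize soliton p ω τ x = f
    generalize √ω = s at hs
    rw [← hs]
    ring
  have hlim : Tendsto (fun x => solitonDeriv p ω τ x * soliton p ω τ x) atTop (𝓝 0) := by
    have h := ((tendsto_soliton hp hω (τ := τ)).pow 2).const_mul √ω
    rw [zero_pow two_ne_zero, mul_zero] at h
    refine squeeze_zero_norm (fun x => ?_) h
    have h1 := abs_le_one_iff_mul_self_le_one.2
      ((pow_two _).symm.trans_le (tanh_sq_le_one ((p - 1) * √ω / 2 * x - τ)))
    rw [solitonDeriv, mul_assoc, norm_mul, norm_neg, norm_mul, Real.norm_of_nonneg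
      (Real.sqrt_nonneg _), ← pow_two, Real.norm_of_nonneg (sq_nonneg (soliton p ω τ x)),
      Real.norm_eq_abs]
    have := mul_le_of_le_one_right (Real.sqrt_nonneg ω) h1
    gcongr
  have h := integral_Ioi_of_hasDerivAt_of_tendsto' hd ((iA.add iB).sub iC) hlim
  rw [← integral_const_mul, ← integral_add iA iB]
  refine (integral_sub (iA.add iB) iC).symm.trans (h.trans ?_)
  simp only [solitonDeriv, mul_zero, zero_sub, Real.tanh_neg]
  ring

theorem tanh_nonneg_of_nonneg {y : ℝ} (h : 0 ≤ y) : 0 ≤ Real.tanh y := by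
  rw [Real.tanh_eq_sinh_div_cosh]
  exact div_nonneg (Real.sinh_nonneg_iff.2 h) (Real.cosh_pos y).le

theorem hasDerivAt_orbitPrimitive_soliton (hp : 1 < p) (hω : 0 < ω) (x : ℝ) :
    HasDerivAt (fun x => orbitPrimitive p ω (soliton p ω τ x))
      (orbitSlope p ω (soliton p ω τ x) * solitonDeriv p ω τ x) x :=
  (hasDerivAt_orbitPrimitive hp _).comp x (hasDerivAt_soliton hp hω x)

/-- Right of the crest `φ' = -orbitSlope p ω φ`, so `φ'²` is minus the derivative of `orbitPrimitive
p ω φ`. Left of the crest the sign is reversed. -/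
theorem integral_Ioi_solitonDeriv_sq (hp : 1 < p) (hω : 0 < ω) {b : ℝ} (hb0 : 0 ≤ b)
    (hb : τ ≤ (p - 1) * √ω / 2 * b) :
    ∫ x in Ioi b, solitonDeriv p ω τ x ^ 2 = orbitPrimitive p ω (soliton p ω τ b) := by
  have hk : 0 ≤ (p - 1) * √ω / 2 := by
    have := Real.sqrt_nonneg ω
    have : 0 ≤ p - 1 := by linarith
    positivity
  have hd : ∀ x ∈ Ici b, HasDerivAt (fun x => -orbitPrimitive p ω (soliton p ω τ x))
      (solitonDeriv p ω τ x ^ 2) x := by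
    intro x hx
    refine (hasDerivAt_orbitPrimitive_soliton hp hω x).neg.congr_deriv ?_
    have := mul_le_mul_of_nonneg_left (show b ≤ x from hx) hk
    rw [orbitSlope_soliton hp hω, abs_of_nonneg (tanh_nonneg_of_nonneg (by linarith)), solitonDeriv]
    ring
  have hlim : Tendsto (fun x => -orbitPrimitive p ω (soliton p ω τ x)) atTop
      (𝓝 (-orbitPrimitive p ω 0)) :=
    (((continuous_orbitPrimitive hp).tendsto 0).comp (tendsto_soliton hp hω)).neg
  rw [integral_Ioi_of_hasDerivAt_of_tendsto' hd
    ((integrableOn_solitonDeriv_sq hp hω).mono_set (Ioi_subset_Ioi hb0)) hlim]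
  simp

theorem intervalIntegral_solitonDeriv_sq (hp : 1 < p) (hω : 0 < ω) {b : ℝ} (hb0 : 0 ≤ b)
    (hb : (p - 1) * √ω / 2 * b ≤ τ) :
    ∫ x in (0 : ℝ)..b, solitonDeriv p ω τ x ^ 2 =
      orbitPrimitive p ω (soliton p ω τ b) - orbitPrimitive p ω (soliton p ω τ 0) := by
  have hk : 0 ≤ (p - 1) * √ω / 2 := by
    have := Real.sqrt_nonneg ω
    have : 0 ≤ p - 1 := by linarith
    positivity
  refine intervalIntegral.integral_eq_sub_of_hasDerivAt (f := fun x =>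
    orbitPrimitive p ω (soliton p ω τ x)) (fun x hx => ?_)
    (((continuous_solitonDeriv hp hω).pow 2).intervalIntegrable _ _)
  rw [uIcc_of_le hb0] at hx
  refine (hasDerivAt_orbitPrimitive_soliton hp hω x).congr_deriv ?_
  have := mul_le_mul_of_nonneg_left hx.2 hk
  have h1 : 0 ≤ Real.tanh (τ - (p - 1) * √ω / 2 * x) := tanh_nonneg_of_nonneg (by linarith)
  rw [← neg_sub, Real.tanh_neg] at h1
  rw [orbitSlope_soliton hp hω, abs_of_nonpos (by linarith), solitonDeriv]
  ring

/-- The action of the soliton on the half-line equals the ground state level. -/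
theorem soliton_orbitLevel (hp : 1 < p) (hω : 0 < ω) {γ : ℝ} (hγ : 0 ≤ γ ↔ 0 ≤ τ) :
    (∫ x in Ioi 0, solitonDeriv p ω τ x ^ 2) + γ / 2 * soliton p ω τ 0 ^ 2 =
      orbitLevel p ω γ (solitonHeight p ω) (soliton p ω τ 0) := by
  have hk : 0 < (p - 1) * √ω / 2 := by
    have := Real.sqrt_pos.2 hω
    have : 0 < p - 1 := by linarith
    positivity
  rw [orbitLevel]
  split_ifs with h
  · rw [hγ] at h
    -- For `τ ≥ 0` the crest lies on the half-line and splits the integral; for `τ < 0` the soliton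
    -- only decreases there.
    have hb : (p - 1) * √ω / 2 * (τ / ((p - 1) * √ω / 2)) = τ := mul_div_cancel₀ _ hk.ne'
    have hb0 : 0 ≤ τ / ((p - 1) * √ω / 2) := div_nonneg h hk.le
    have h1 := integral_Ioi_solitonDeriv_sq hp hω hb0 hb.ge
    have h2 := intervalIntegral_solitonDeriv_sq hp hω hb0 hb.le
    rw [soliton_eq_height hb] at h1 h2
    have h3 := intervalIntegral.integral_Ioi_sub_Ioi
      (integrableOn_solitonDeriv_sq hp hω (τ := τ)) hb0
    linarith
  · rw [hγ] at h
    rw [integral_Ioi_solitonDeriv_sq hp hω le_rfl (by linarith)]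
    ring

/-! ### Reduction of the graph to a single half-line. -/

section Symmetric

variable {N : ℕ} {v : Fin N → ℝ → ℂ}

theorem normPow_eq_of_ae_eq {U : ℝ → ℂ} (hv : ∀ j, v j =ᵐ[halfLine] U) (q : ℝ) :
    normPow q v = N * ∫ x in Ioi 0, ‖U x‖ ^ q := by
  have h : ∀ j, ∫ x, ‖v j x‖ ^ q ∂halfLine = ∫ x in Ioi 0, ‖U x‖ ^ q := fun j =>
    integral_congr_ae ((hv j).fun_comp fun z => ‖z‖ ^ q)
  simp [normPow, h]

theorem quadForm_eq_of_ae_eq {g : ℝ → ℂ} {c : ℂ} (hg : LocallyIntegrable g volume)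
    (hv : ∀ j, v j =ᵐ[halfLine] fun x => c + ∫ t in (0 : ℝ)..x, g t) (β : ℝ) :
    quadForm β v = N * ((∫ x in Ioi 0, ‖g x‖ ^ 2) + N / β * ‖c‖ ^ 2) := by
  have hw : ∀ j, weakDeriv (v j) =ᵐ[halfLine] g := fun j =>
    ((isWeakDeriv_primitive hg c).congr_left (hv j).symm).weakDeriv_ae_eq
  have hb : ∀ j, boundaryValue (v j) = c := fun j => by
    rw [boundaryValue_eq (continuous_primitive hg c) (hv j)]; simp
  rw [quadForm, normPow_eq_of_ae_eq hw]
  simp only [hb, Finset.sum_const, Finset.card_univ, Fintype.card_fin, nsmul_eq_mul, norm_mul,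
    Complex.norm_natCast, Real.rpow_two]
  ring

variable {p ω β : ℝ}

theorem nehari_eq_of_ae_eq {g : ℝ → ℂ} {c : ℂ} (hg : LocallyIntegrable g volume)
    (hv : ∀ j, v j =ᵐ[halfLine] fun x => c + ∫ t in (0 : ℝ)..x, g t) :
    nehari p ω β v = N * ((∫ x in Ioi 0, ‖g x‖ ^ 2) + N / β * ‖c‖ ^ 2 +
      ω * (∫ x in Ioi 0, ‖c + ∫ t in (0 : ℝ)..x, g t‖ ^ 2) -
      ∫ x in Ioi 0, ‖c + ∫ t in (0 : ℝ)..x, g t‖ ^ (p + 1)) := by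
  rw [nehari, quadForm_eq_of_ae_eq hg hv, normPow_eq_of_ae_eq hv, normPow_eq_of_ae_eq hv]
  simp only [Real.rpow_two]
  ring

theorem action_eq_of_ae_eq {g : ℝ → ℂ} {c : ℂ} (hg : LocallyIntegrable g volume)
    (hv : ∀ j, v j =ᵐ[halfLine] fun x => c + ∫ t in (0 : ℝ)..x, g t) :
    action p ω β v = N * (1 / 2 * ((∫ x in Ioi 0, ‖g x‖ ^ 2) + N / β * ‖c‖ ^ 2 +
      ω * (∫ x in Ioi 0, ‖c + ∫ t in (0 : ℝ)..x, g t‖ ^ 2)) -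
      1 / (p + 1) * ∫ x in Ioi 0, ‖c + ∫ t in (0 : ℝ)..x, g t‖ ^ (p + 1)) := by
  rw [action, quadForm_eq_of_ae_eq hg hv, normPow_eq_of_ae_eq hv, normPow_eq_of_ae_eq hv]
  simp only [Real.rpow_two]
  ring

/-- On the symmetric Nehari set the action is at least the ground state level. -/
theorem orbitLevel_le_action (hN : 0 < N) (hp : 1 < p) {M a : ℝ}
    (hM : 2 / (p + 1) * M ^ (p - 1) = ω)
    (ha : (N / β) ^ 2 = ω - 2 / (p + 1) * a ^ (p - 1)) (ha0 : 0 < a) (haM : a ≤ M)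
    (hv : v ∈ nehariEq N p ω β) : N * orbitLevel p ω (N / β) M a ≤ action p ω β v := by
  obtain ⟨⟨hH1, heq⟩, hne, hI⟩ := hv
  obtain ⟨c, g, hg, hf⟩ := (hH1 ⟨0, hN⟩).exists_primitive
  have hgl := hg.locallyIntegrable (by norm_num)
  have hvU : ∀ j, v j =ᵐ[halfLine] fun x => c + ∫ t in (0 : ℝ)..x, g t := fun j =>
    (heq j _).trans hf
  have hU : MemLp (fun x => c + ∫ t in (0 : ℝ)..x, g t) 2 halfLine :=
    (memLp_congr_ae hf).1 (hH1 ⟨0, hN⟩).1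
  obtain ⟨x₁, hx₁, h1⟩ : ∃ x₁, 0 ≤ x₁ ∧ c + ∫ t in (0 : ℝ)..x₁, g t ≠ 0 := by
    by_contra! hcon
    refine hne fun j => (hvU j).trans ?_
    rw [EventuallyEq, halfLine, ae_restrict_iff' measurableSet_Ioi]
    exact ae_of_all _ fun x hx => hcon x (le_of_lt hx)
  have hN' : (0 : ℝ) < N := by exact_mod_cast hN
  rw [nehari_eq_of_ae_eq hgl hvU] at hI
  have hI' := sub_eq_zero.1 ((mul_eq_zero.1 hI).resolve_left hN'.ne')
  rw [action_eq_of_ae_eq hgl hvU, hI', ← sub_mul]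
  exact mul_le_mul_of_nonneg_left (orbitLevel_le_of_nehari hp hg hU hx₁ h1 hM ha ha0 haM hI')
    hN'.le

end Symmetric

/-! ### The symmetric profile lies in the Nehari set and reaches the level. -/

section Profile

variable {N : ℕ} {p ω β : ℝ}

theorem soliton_eq_primitive (hp : 1 < p) (hω : 0 < ω) (τ x : ℝ) :
    (soliton p ω τ 0 : ℂ) + ∫ t in (0 : ℝ)..x, (solitonDeriv p ω τ t : ℂ) = soliton p ω τ x := by
  have h : ∫ t in (0 : ℝ)..x, solitonDeriv p ω τ t = soliton p ω τ x - soliton p ω τ 0 :=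
    intervalIntegral.integral_eq_sub_of_hasDerivAt (fun x _ => hasDerivAt_soliton hp hω x)
      ((continuous_solitonDeriv hp hω).intervalIntegrable _ _)
  rw [intervalIntegral.integral_ofReal, h, ← Complex.ofReal_add, add_sub_cancel]

theorem profile_eq_primitive (hp : 1 < p) (hω : 0 < ω) (j : Fin N) :
    profile N p ω β j = fun x => (soliton p ω (Real.artanh (N / (β * √ω))) 0 : ℂ) +
      ∫ t in (0 : ℝ)..x, (solitonDeriv p ω (Real.artanh (N / (β * √ω))) t : ℂ) :=
  funext fun x => (soliton_eq_primitive hp hω _ x).symm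

theorem memLp_two_ofReal {f : ℝ → ℝ} (hf : Continuous f)
    (hi : IntegrableOn (fun x => f x ^ 2) (Ioi 0)) :
    MemLp (fun x => (f x : ℂ)) 2 halfLine := by
  have hc : Continuous fun x => (f x : ℂ) := Complex.continuous_ofReal.comp hf
  rw [memLp_two_iff_integrable_sq_norm hc.aestronglyMeasurable]
  simpa using! hi

theorem locallyIntegrable_solitonDeriv (hp : 1 < p) (hω : 0 < ω) (τ : ℝ) :
    LocallyIntegrable (fun t => (solitonDeriv p ω τ t : ℂ)) volume :=
  (Complex.continuous_ofReal.comp (continuous_solitonDeriv hp hω)).locallyIntegrable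

theorem profile_mem_H1eq (hp : 1 < p) (hω : 0 < ω) : profile N p ω β ∈ H1eq N := by
  refine ⟨fun j => ⟨memLp_two_ofReal (continuous_soliton hp hω) (integrableOn_soliton_sq hp hω),
    fun x => solitonDeriv p ω (Real.artanh (N / (β * √ω))) x, memLp_two_ofReal (continuous_solitonDeriv hp hω) (integrableOn_solitonDeriv_sq hp hω),
    ?_⟩, fun i j => Eventually.of_forall fun x => rfl⟩
  rw [profile_eq_primitive hp hω j]
  exact isWeakDeriv_primitive (locallyIntegrable_solitonDeriv hp hω _) _

theorem not_isZero_profile (hN : 0 < N) (hp : 1 < p) (hω : 0 < ω) :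
    ¬ IsZero (profile N p ω β) := by
  intro h
  have h0 := h ⟨0, hN⟩
  rw [EventuallyEq, halfLine] at h0
  have hne : ∀ x, profile N p ω β ⟨0, hN⟩ x ≠ 0 := fun x =>
    Complex.ofReal_ne_zero.2 (soliton_pos hp hω x).ne'
  have hF : ∀ᵐ x ∂(volume.restrict (Ioi (0 : ℝ))), False := h0.mono fun x hx => hne x hx
  rw [eventually_false_iff_eq_bot, ae_eq_bot, Measure.restrict_eq_zero] at hF
  simp at hF

theorem nehari_profile (hp : 1 < p) (hω : 0 < ω)
    (hτ : √ω * Real.tanh (Real.artanh (N / (β * √ω))) = N / β) :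
    nehari p ω β (profile N p ω β) = 0 := by
  rw [nehari_eq_of_ae_eq (locallyIntegrable_solitonDeriv hp hω _)
    fun j => (profile_eq_primitive hp hω j).eventuallyEq]
  have h := soliton_nehari (τ := Real.artanh (N / (β * √ω))) hp hω
  rw [hτ] at h
  simp only [soliton_eq_primitive hp hω, Complex.norm_real, Real.norm_eq_abs, sq_abs,
    abs_of_pos (soliton_pos hp hω _)]
  rw [mul_eq_zero]
  right
  linarith

theorem action_profile (hp : 1 < p) (hω : 0 < ω)
    (hγ : 0 ≤ N / β ↔ 0 ≤ Real.artanh (N / (β * √ω))) :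
    action p ω β (profile N p ω β) = N * orbitLevel p ω (N / β) (solitonHeight p ω)
      (soliton p ω (Real.artanh (N / (β * √ω))) 0) := by
  rw [action_eq_of_ae_eq (locallyIntegrable_solitonDeriv hp hω _)
    fun j => (profile_eq_primitive hp hω j).eventuallyEq, ← soliton_orbitLevel hp hω hγ]
  simp only [soliton_eq_primitive hp hω, Complex.norm_real, Real.norm_eq_abs, sq_abs,
    abs_of_pos (soliton_pos hp hω _)]
  set τ := Real.artanh (N / (β * √ω))
  -- By the integrated first integral, the action without the Robin term reduces to `∫ φ'²`.
  have h : 2 / (p + 1) * (∫ x in Ioi 0, soliton p ω τ x ^ (p + 1)) =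
      ω * (∫ x in Ioi 0, soliton p ω τ x ^ 2) - ∫ x in Ioi 0, solitonDeriv p ω τ x ^ 2 := by
    rw [← integral_const_mul, ← integral_const_mul, ← integral_sub
      ((integrableOn_soliton_sq hp hω).const_mul ω) (integrableOn_solitonDeriv_sq hp hω)]
    simp only [soliton_rpow_add_one hp hω]
  congr 1
  linear_combination -(1 / 2) * h

end Profile

end StarGraph

theorem lemma3p3 (N : ℕ) (hN : 2 ≤ N) (p ω β : ℝ) (hp : 1 < p) (hβ : β ≠ 0)
    (hω : (N : ℝ) ^ 2 / β ^ 2 < ω) :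
    StarGraph.profile N p ω β ∈ StarGraph.nehariEq N p ω β ∧
      (∀ v ∈ StarGraph.nehariEq N p ω β,
        StarGraph.action p ω β (StarGraph.profile N p ω β) ≤ StarGraph.action p ω β v) ∧
      StarGraph.dEq N p ω β = StarGraph.action p ω β (StarGraph.profile N p ω β) := by
  have hN0 : 0 < N := by omega
  have hω0 : 0 < ω := lt_of_le_of_lt (by positivity) hω
  have hs : 0 < √ω := Real.sqrt_pos.2 hω0
  have hss : √ω ^ 2 = ω := Real.sq_sqrt hω0.le
  have hq : (N : ℝ) / (β * √ω) = N / β / √ω := by rw [div_div]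
  -- The condition `ω > N² / β²` puts the argument of `Real.artanh` in `(-1, 1)`, where `Real.tanh`
  -- inverts it.
  have hlt : |(N : ℝ) / β / √ω| < 1 := by
    rw [← sq_lt_one_iff_abs_lt_one, div_pow, hss, div_lt_one hω0, div_pow]
    exact hω
  have hmem : (N : ℝ) / (β * √ω) ∈ Ioo (-1) 1 := by
    rw [hq]; exact ⟨(abs_lt.1 hlt).1, (abs_lt.1 hlt).2⟩
  have hτ : √ω * Real.tanh (Real.artanh (N / (β * √ω))) = N / β := by
    rw [Real.tanh_artanh hmem, hq, mul_div_cancel₀ _ hs.ne']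
  have hγ : 0 ≤ (N : ℝ) / β ↔ 0 ≤ Real.artanh (N / (β * √ω)) := by
    rw [hq]
    refine ⟨fun h => Real.artanh_nonneg (div_nonneg h hs.le), fun h => ?_⟩
    by_contra hneg
    exact absurd (Real.artanh_neg ⟨(abs_lt.1 hlt).1, div_neg_of_neg_of_pos (not_le.1 hneg) hs⟩)
      (not_lt.2 h)
  -- The boundary value `a` of the soliton is where `orbitSlope p ω a = |γ| a`.
  have ha : ((N : ℝ) / β) ^ 2 = ω - 2 / (p + 1) *
      StarGraph.soliton p ω (Real.artanh (N / (β * √ω))) 0 ^ (p - 1) := by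
    rw [StarGraph.soliton_rpow_eq_tanh hp hω0, ← hτ, mul_zero, zero_sub, Real.tanh_neg, mul_pow,
      hss]
    ring
  have hmemP : StarGraph.profile N p ω β ∈ StarGraph.nehariEq N p ω β :=
    ⟨StarGraph.profile_mem_H1eq hp hω0, StarGraph.not_isZero_profile hN0 hp hω0,
      StarGraph.nehari_profile hp hω0 hτ⟩
  have hmin : ∀ v ∈ StarGraph.nehariEq N p ω β,
      StarGraph.action p ω β (StarGraph.profile N p ω β) ≤ StarGraph.action p ω β v := by
    intro v hv
    rw [StarGraph.action_profile hp hω0 hγ]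
    exact StarGraph.orbitLevel_le_action hN0 hp (StarGraph.solitonHeight_rpow hp hω0) ha
      (StarGraph.soliton_pos hp hω0 _) (StarGraph.soliton_le_height hp hω0 _) hv
  refine ⟨hmemP, hmin, IsLeast.csInf_eq ⟨mem_image_of_mem _ hmemP, ?_⟩⟩
  rintro _ ⟨v, hv, rfl⟩
  exact hmin v hv
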